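/- Let $n\ge 1$ and $0<\lambda\le\Lambda<\infty$, and write $B_r=\{x\in\mathbb R^n:|x|<r\}$. Call a measurable matrix function $(a_{ij})$ on $B_r$ (not necessarily symmetric) $(\lambda,\Lambda)$-elliptic if for a.e. $x\in B_r$ one has $\lambda|\xi|^2\le\sum_{i,j}a_{ij}(x)\xi_i\xi_j\le\Lambda|\xi|^2$ for all $\xi\in\mathbb R^n$ and $|a_{ij}(x)|\le\Lambda$ for all $i,j$. A function $u\in H^1(B_r)$ is a subsolution of $-D_j(a_{ij}D_iu)=0$ in $B_r$ if $\int_{B_r}\sum_{i,j}a_{ij}\,D_iu\,D_jv\,dx\le 0$ for every $v\in H^1_0(B_r)$ with $v\ge 0$. Write $m_r(w)=\Big(\frac1{|B_r|}\int_{B_r}w^2\,dx\Big)^{1/2}$ for the $L^2$ average over $B_r$. Call $A>1$ a level constant for $(n,\lambda,\Lambda)$ if for every $r>0$, every $(\lambda,\Lambda)$-elliptic $(a_{ij})$ on $B_r$ and every nonnegative subsolution $u$ of $-D_j(a_{ij}D_iu)=0$ in $B_r$, $$m_{r/2}\big((u-A\,m_r(u))^+\big)\le \tfrac12\, m_r(u).$$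 Then a level constant exists for $(n,\lambda,\Lambda)$. Moreover, let $A$ be any level constant for $(n,\lambda,\Lambda)$, let $(a_{ij})$ be $(\lambda,\Lambda)$-elliptic on $B_1$, let $u\ge 0$ be a subsolution of $-D_j(a_{ij}D_iu)=0$ in $B_1$, and suppose that $0$ is a Lebesgue point of $u$, i.e. $\lim_{r\to0^+}\frac1{|B_r|}\int_{B_r}|u(x)-u(0)|\,dx=0$. Then $$u(0)\le 2A\left(\frac1{|B_1|}\int_{B_1}u^2\,dx\right)^{1/2}.$$ -/

import Mathlib

open MeasureTheory Filter Topology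
open scoped ENNReal ContDiff

noncomputable section

namespace DeGiorgi

/-- Euclidean space `ℝⁿ`. -/
abbrev Eucl (n : ℕ) : Type := EuclideanSpace ℝ (Fin n)

/-- The open ball `B_r` with center `0`. -/
abbrev ballZero (n : ℕ) (r : ℝ) : Set (Eucl n) := Metric.ball (0 : Eucl n) r

/-- `φ ∈ C_c^∞(Ω)`. -/
def IsTestFunction {n : ℕ} (Ω : Set (Eucl n)) (φ : Eucl n → ℝ) : Prop :=
  ContDiff ℝ ∞ φ ∧ HasCompactSupport φ ∧ tsupport φ ⊆ Ω

/-- `g` is the weak gradient of `u` in `Ω`: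
`∫_Ω u D_i φ = - ∫_Ω g_i φ` for all `φ ∈ C_c^∞(Ω)` and all `i`. -/
def IsWeakGradient {n : ℕ} (Ω : Set (Eucl n)) (u : Eucl n → ℝ) (g : Eucl n → Eucl n) : Prop :=
  ∀ φ : Eucl n → ℝ, IsTestFunction Ω φ → ∀ i : Fin n,
    ∫ x in Ω, u x * gradient φ x i = -∫ x in Ω, g x i * φ x

/-- `u ∈ H¹(Ω)` with weak gradient `g`. -/
def InH1 {n : ℕ} (Ω : Set (Eucl n)) (u : Eucl n → ℝ) (g : Eucl n → Eucl n) : Prop :=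
  MemLp u 2 (volume.restrict Ω) ∧ MemLp g 2 (volume.restrict Ω) ∧ IsWeakGradient Ω u g

/-- `v ∈ H¹₀(Ω)` with weak gradient `h`: `v` is in the closure of `C_c^∞(Ω)` in `H¹(Ω)`. -/
def InH10 {n : ℕ} (Ω : Set (Eucl n)) (v : Eucl n → ℝ) (h : Eucl n → Eucl n) : Prop :=
  InH1 Ω v h ∧
  ∃ φ : ℕ → Eucl n → ℝ, (∀ k, IsTestFunction Ω (φ k)) ∧
    Tendsto (fun k => eLpNorm (fun x => v x - φ k x) 2 (volume.restrict Ω)) atTop (𝓝 0) ∧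
    Tendsto (fun k => eLpNorm (fun x => h x - gradient (φ k) x) 2 (volume.restrict Ω))
      atTop (𝓝 0)

/-- Measurable coefficients `a_ij` in `Ω` (not necessarily symmetric) with
`λ|ξ|² ≤ a_ij ξ_i ξ_j ≤ Λ|ξ|²` and `|a_ij| ≤ Λ` a.e. in `Ω`. -/
def UniformlyElliptic {n : ℕ} (Ω : Set (Eucl n)) (lam Lam : ℝ)
    (a : Eucl n → Matrix (Fin n) (Fin n) ℝ) : Prop :=
  (∀ i j, AEMeasurable (fun x => a x i j) (volume.restrict Ω)) ∧
  ∀ᵐ x ∂(volume.restrict Ω),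
    (∀ ξ : Eucl n, lam * ‖ξ‖ ^ 2 ≤ ∑ i, ∑ j, a x i j * ξ i * ξ j ∧
      ∑ i, ∑ j, a x i j * ξ i * ξ j ≤ Lam * ‖ξ‖ ^ 2) ∧
    ∀ i j, |a x i j| ≤ Lam

/-- `u ∈ H¹(Ω)` is a subsolution: `-D_j(a_ij D_i u) ≤ 0` in `Ω`, tested against all
nonnegative `v ∈ H¹₀(Ω)`. -/
def IsSubsolution {n : ℕ} (Ω : Set (Eucl n)) (a : Eucl n → Matrix (Fin n) (Fin n) ℝ)
    (u : Eucl n → ℝ) : Prop :=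
  ∃ g : Eucl n → Eucl n, InH1 Ω u g ∧
    ∀ (v : Eucl n → ℝ) (h : Eucl n → Eucl n), InH10 Ω v h →
      (∀ᵐ x ∂(volume.restrict Ω), 0 ≤ v x) →
      ∫ x in Ω, ∑ i, ∑ j, a x i j * g x i * h x j ≤ 0

/-- A nonnegative subsolution in `Ω`. -/
def IsNonnegSubsolution {n : ℕ} (Ω : Set (Eucl n)) (a : Eucl n → Matrix (Fin n) (Fin n) ℝ)
    (u : Eucl n → ℝ) : Prop :=
  IsSubsolution Ω a u ∧ ∀ᵐ x ∂(volume.restrict Ω), 0 ≤ u x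

/-- The `L²` average of `u` over `B_r`. -/
def l2avg {n : ℕ} (r : ℝ) (u : Eucl n → ℝ) : ℝ :=
  Real.sqrt (⨍ x in ballZero n r, u x ^ 2)

/-- `0` is a Lebesgue point of `u`: the averages of `|u - u(0)|` over `B_r` tend to `0`. -/
def IsLebesguePointZero {n : ℕ} (u : Eucl n → ℝ) : Prop :=
  Tendsto (fun r : ℝ => ⨍ x in ballZero n r, |u x - u 0|) (𝓝[>] 0) (𝓝 0)

/-- `A > 1` is a level constant for the dimension `n` and the ellipticity constants `λ, Λ`:
for every equation with these ellipticity constants in a ball `B_r` and every nonnegative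
subsolution `u` in `B_r` with `L²` average `m` over `B_r`, the `L²` average of `(u - A m)⁺` over
`B_{r/2}` is at most `m / 2`. -/
def IsLevelConstant (n : ℕ) (lam Lam A : ℝ) : Prop :=
  1 < A ∧ ∀ (r : ℝ), 0 < r → ∀ a : Eucl n → Matrix (Fin n) (Fin n) ℝ,
    UniformlyElliptic (ballZero n r) lam Lam a →
    ∀ u : Eucl n → ℝ, IsNonnegSubsolution (ballZero n r) a u →
      l2avg (r / 2) (fun x => max (u x - A * l2avg r u) 0) ≤ 1 / 2 * l2avg r u

end DeGiorgi

end

noncomputable section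

namespace DeGiorgi

/-! ### Gradients in coordinates and the effect of translations in `L²`. -/

section Basic

variable {n : ℕ}

/-! Existence of a level constant is one De Giorgi step. For `t = A m_r(u)` the truncation `w = (u -
t)⁺` is again a subsolution (`IsSubsolution.posPart`), so Caccioppoli's inequality (`caccioppoli`),
for a cutoff `η` equal to `1` on `B_{r/2}`, bounds the energy of `η w` by a multiple of `r⁻² ∫ u²`.
Moreover `w` lives on `{u > t}`, which by Chebyshev occupies at most the fraction `A⁻²` of `B_r`.

No Sobolev inequality is needed to exploit this smallness. Comparing `v` with its translates by
vectors of length less than `δ` gives, for `v ∈ H¹₀`, `‖v‖²_{L²(E)} ≤ 2δ² ‖∇v‖² + 2 (|E| / |B_δ|)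
‖v‖²` (`InH10.measure_ball_mul_eLpNorm_le`), in every dimension alike. Taking `v = η w` and `δ = θ
r`, a small `θ` makes the first term small, and then a large `A` the second
(`exists_isLevelConstant`).

The bound at `0` iterates this on the balls of radius `2⁻ᵏ`. Let `t_0 = 0`, let `m_k` be the `L²`
average of `(u - t_k)⁺`, and put `t_{k+1} = t_k + A m_k`. The level property halves `m_k` at each
step, so the levels stay below `A m_0 (1 + 1/2 + 1/4 + ⋯) = 2 A m_0`, while `m_k → 0`. Averaging
`u(0) - t_k ≤ |u - u(0)| + (u - t_k)⁺` over the `k`-th ball and letting `k → ∞` at the Lebesgue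
point gives the claim (`le_of_isLebesguePointZero`).

The rest is `H¹` calculus: approximation by mollification, the chain rule, truncation, and the
reduction of nonnegative `H¹₀` test functions to smooth ones. -/

lemma gradient_apply (f : Eucl n → ℝ) (x : Eucl n) (i : Fin n) :
    gradient f x i = fderiv ℝ f x (EuclideanSpace.single i 1) := by
  rw [← toDual_gradient, InnerProductSpace.toDual_apply_apply, EuclideanSpace.inner_single_right]
  simp

lemma norm_gradient (f : Eucl n → ℝ) (x : Eucl n) : ‖gradient f x‖ = ‖fderiv ℝ f x‖ := by
  rw [← toDual_gradient, LinearIsometryEquiv.norm_map]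

lemma gradient_eq_toDual_symm (f : Eucl n → ℝ) :
    gradient f = fun x => (InnerProductSpace.toDual ℝ (Eucl n)).symm (fderiv ℝ f x) := rfl

lemma continuous_gradient {f : Eucl n → ℝ} (hf : ContDiff ℝ 1 f) : Continuous (gradient f) := by
  rw [gradient_eq_toDual_symm]
  exact (LinearIsometryEquiv.continuous _).comp (hf.continuous_fderiv one_ne_zero)

lemma support_gradient_subset (f : Eucl n → ℝ) :
    Function.support (gradient f) ⊆ tsupport f := by
  intro x hx
  apply support_fderiv_subset ℝ
  rw [Function.mem_support] at hx ⊢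
  rw [← norm_ne_zero_iff] at hx ⊢
  rwa [← norm_gradient]

lemma gradient_eq_zero_of_notMem {f : Eucl n → ℝ} {x : Eucl n} (hx : x ∉ tsupport f) :
    gradient f x = 0 := by
  by_contra h
  exact hx (support_gradient_subset f h)

lemma hasCompactSupport_gradient {f : Eucl n → ℝ} (hf : HasCompactSupport f) :
    HasCompactSupport (gradient f) :=
  hf.mono' (support_gradient_subset f)

lemma gradient_mul {f g : Eucl n → ℝ} {x : Eucl n} (hf : DifferentiableAt ℝ f x)
    (hg : DifferentiableAt ℝ g x) :
    gradient (fun y => f y * g y) x = f x • gradient g x + g x • gradient f x := by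
  ext i
  simp only [gradient_apply, PiLp.add_apply, PiLp.smul_apply]
  rw [fderiv_fun_mul hf hg]
  simp

lemma gradient_comp {F : ℝ → ℝ} {f : Eucl n → ℝ} {x : Eucl n} (hF : DifferentiableAt ℝ F (f x))
    (hf : DifferentiableAt ℝ f x) :
    gradient (fun y => F (f y)) x = deriv F (f x) • gradient f x := by
  ext i
  simp only [gradient_apply, PiLp.smul_apply]
  have := (hF.hasDerivAt.comp_hasFDerivAt x hf.hasFDerivAt).fderiv
  change fderiv ℝ (F ∘ f) x _ = _
  rw [this]; simp

lemma sq_lintegral_le {α : Type*} [MeasurableSpace α] (ν : Measure α) [IsProbabilityMeasure ν]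
    {h : α → ℝ≥0∞} (hh : AEMeasurable h ν) : (∫⁻ a, h a ∂ν) ^ 2 ≤ ∫⁻ a, h a ^ 2 ∂ν := by
  have := ENNReal.lintegral_mul_le_Lp_mul_Lq ν Real.HolderConjugate.two_two hh
    (aemeasurable_const (b := (1 : ℝ≥0∞)))
  simp only [Pi.mul_apply, mul_one, lintegral_const, measure_univ, ENNReal.rpow_two, one_pow,
    ENNReal.one_rpow] at this
  calc (∫⁻ a, h a ∂ν) ^ 2 ≤ ((∫⁻ a, h a ^ 2 ∂ν) ^ (1 / 2 : ℝ)) ^ 2 := by gcongr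
    _ = _ := by
      rw [← ENNReal.rpow_two, ← ENNReal.rpow_mul]; norm_num

lemma eLpNorm_two_sq {α E : Type*} [MeasurableSpace α] [NormedAddCommGroup E] (ν : Measure α)
    (f : α → E) : eLpNorm f 2 ν ^ 2 = ∫⁻ x, ‖f x‖ₑ ^ 2 ∂ν := by
  have := eLpNorm_nnreal_pow_eq_lintegral (μ := ν) (f := f) (p := 2) two_ne_zero
  simpa using this

lemma enorm_translate_sub_le {f : Eucl n → ℝ} (hf : ContDiff ℝ 1 f) (x t : Eucl n) :
    ‖f (x + t) - f x‖ₑ ≤ ∫⁻ s in Set.Ioc (0 : ℝ) 1, ‖fderiv ℝ f (x + s • t)‖ₑ * ‖t‖ₑ := by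
  have hd : ∀ s : ℝ, HasDerivAt (fun s : ℝ => f (x + s • t)) (fderiv ℝ f (x + s • t) t) s := by
    intro s
    have h1 : HasDerivAt (fun s : ℝ => x + s • t) t s := by
      simpa using ((hasDerivAt_id s).smul_const t).const_add x
    exact ((hf.differentiable one_ne_zero) _).hasFDerivAt.comp_hasDerivAt s h1
  have hc : Continuous fun s : ℝ => fderiv ℝ f (x + s • t) t :=
    ((hf.continuous_fderiv one_ne_zero).comp (by fun_prop)).clm_apply continuous_const
  have := intervalIntegral.integral_eq_sub_of_hasDerivAt (a := 0) (b := 1)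
    (fun s _ => hd s) (hc.intervalIntegrable _ _)
  simp only [one_smul, zero_smul, add_zero] at this
  rw [← this, intervalIntegral.integral_of_le zero_le_one]
  refine (enorm_integral_le_lintegral_enorm _).trans (lintegral_mono fun s => ?_)
  exact ContinuousLinearMap.le_opENorm _ _

/-- Fundamental theorem of calculus along the segment, Jensen in the segment parameter, Tonelli, and
translation invariance. Besides mollification, this serves the small-set estimate, where it takes
the place of a Sobolev inequality. -/
lemma lintegral_translate_sub_le {f : Eucl n → ℝ} (hf : ContDiff ℝ 1 f) (t : Eucl n) :
    ∫⁻ x, ‖f (x + t) - f x‖ₑ ^ 2 ≤ ‖t‖ₑ ^ 2 * ∫⁻ x, ‖gradient f x‖ₑ ^ 2 := by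
  have hc := hf.continuous_fderiv one_ne_zero
  have : IsProbabilityMeasure (volume.restrict (Set.Ioc (0 : ℝ) 1)) := ⟨by simp⟩
  have hjm : Measurable (fun p : Eucl n × ℝ => (‖fderiv ℝ f (p.1 + p.2 • t)‖ₑ * ‖t‖ₑ) ^ 2) := by
    have : Continuous (fun p : Eucl n × ℝ => fderiv ℝ f (p.1 + p.2 • t)) := hc.comp (by fun_prop)
    exact (this.enorm.measurable.mul_const _).pow_const _
  calc ∫⁻ x, ‖f (x + t) - f x‖ₑ ^ 2
      ≤ ∫⁻ x, ∫⁻ s in Set.Ioc (0 : ℝ) 1, (‖fderiv ℝ f (x + s • t)‖ₑ * ‖t‖ₑ) ^ 2 := by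
        refine lintegral_mono fun x => ?_
        refine (pow_le_pow_left' (enorm_translate_sub_le hf x t) 2).trans (sq_lintegral_le _ ?_)
        have : Continuous (fun s : ℝ => fderiv ℝ f (x + s • t)) := hc.comp (by fun_prop)
        exact (this.enorm.measurable.mul_const _).aemeasurable
    _ = ∫⁻ s in Set.Ioc (0 : ℝ) 1, ∫⁻ x, (‖fderiv ℝ f (x + s • t)‖ₑ * ‖t‖ₑ) ^ 2 :=
        lintegral_lintegral_swap hjm.aemeasurable
    _ = ∫⁻ s in Set.Ioc (0 : ℝ) 1, ∫⁻ x, (‖fderiv ℝ f x‖ₑ * ‖t‖ₑ) ^ 2 := by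
        congr 1; ext s
        exact lintegral_add_right_eq_self (fun x => (‖fderiv ℝ f x‖ₑ * ‖t‖ₑ) ^ 2) (s • t)
    _ = _ := by
        simp only [lintegral_const, measure_univ, mul_one, mul_pow]
        rw [lintegral_mul_const' _ _ (by simp), mul_comm]
        congr 2; ext x
        rw [← ofReal_norm, ← ofReal_norm, norm_gradient]

lemma eLpNorm_translate_sub_le {f : Eucl n → ℝ} (hf : ContDiff ℝ 1 f) (t : Eucl n) :
    eLpNorm (fun x => f (x + t) - f x) 2 volume ≤ ‖t‖ₑ * eLpNorm (gradient f) 2 volume := by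
  rw [← ENNReal.pow_le_pow_left_iff (n := 2) two_ne_zero, mul_pow, eLpNorm_two_sq, eLpNorm_two_sq]
  exact lintegral_translate_sub_le hf t

/-- An `ε/3` argument: for compactly supported smooth functions the previous bound is linear in
`‖t‖`, and these are dense. -/
lemma tendsto_eLpNorm_translate_sub {f : Eucl n → ℝ} (hf : MemLp f 2 volume) :
    Tendsto (fun t : Eucl n => eLpNorm (fun x => f (x + t) - f x) 2 volume) (𝓝 0) (𝓝 0) := by
  rw [ENNReal.tendsto_nhds_zero]
  intro ε hε
  by_cases hεt : ε = ⊤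
  · simp [hεt]
  have hε3 : 0 < (ε / 3).toReal := ENNReal.toReal_pos
    (ENNReal.div_pos hε.ne' (by simp)).ne' (ENNReal.div_lt_top hεt (by simp)).ne
  have h3 : ENNReal.ofReal (ε / 3).toReal = ε / 3 :=
    ENNReal.ofReal_toReal (ENNReal.div_lt_top hεt (by simp)).ne
  obtain ⟨g, hgc, hgd, hg⟩ := hf.exist_eLpNorm_sub_le (by simp) (by norm_num) hε3
  rw [h3] at hg
  have hg1 : ContDiff ℝ 1 g := hgd.of_le (by simp)
  have hGfin : eLpNorm (gradient g) 2 volume ≠ ⊤ :=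
    ((continuous_gradient hg1).memLp_of_hasCompactSupport (hasCompactSupport_gradient hgc)).2.ne
  have hlim : Tendsto (fun t : Eucl n => ‖t‖ₑ * eLpNorm (gradient g) 2 volume) (𝓝 0) (𝓝 0) := by
    have : Tendsto (fun t : Eucl n => ‖t‖ₑ) (𝓝 0) (𝓝 0) := by
      simpa using (continuous_enorm (E := Eucl n)).tendsto 0
    simpa using ENNReal.Tendsto.mul_const this (Or.inr hGfin)
  have h3pos : 0 < ε / 3 := ENNReal.div_pos hε.ne' (by simp)
  filter_upwards [(ENNReal.tendsto_nhds_zero.1 hlim) (ε / 3) h3pos] with t ht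
  have hfg : AEStronglyMeasurable (f - g) volume :=
    hf.1.sub hg1.continuous.aestronglyMeasurable
  have e : (fun x => f (x + t) - f x)
      = (((fun x => (f - g) (x + t)) + (fun x => g (x + t) - g x)) + (fun x => -(f - g) x)) := by
    ext x; simp
  have hmp := measurePreserving_add_right (volume : Measure (Eucl n)) t
  have h1 : eLpNorm (fun x => (f - g) (x + t)) 2 volume = eLpNorm (f - g) 2 volume :=
    eLpNorm_comp_measurePreserving hfg hmp
  have m1 : AEStronglyMeasurable (fun x => (f - g) (x + t)) volume :=
    hfg.comp_measurePreserving hmp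
  have m2 : AEStronglyMeasurable (fun x => g (x + t) - g x) volume := by
    have := hg1.continuous
    exact Continuous.aestronglyMeasurable (by fun_prop)
  have h2 : eLpNorm (fun x => -(f - g) x) 2 volume = eLpNorm (f - g) 2 volume :=
    eLpNorm_neg (f - g) 2 volume
  rw [e]
  calc _ ≤ eLpNorm (fun x => (f - g) (x + t)) 2 volume + eLpNorm (fun x => g (x + t) - g x) 2 volume
        + eLpNorm (fun x => -(f - g) x) 2 volume :=
        (eLpNorm_add_le (m1.add m2) hfg.neg (by simp)).trans
          (add_le_add (eLpNorm_add_le m1 m2 (by simp)) le_rfl)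
    _ ≤ ε / 3 + ε / 3 + ε / 3 := by
        rw [h1, h2]; gcongr; exact (eLpNorm_translate_sub_le hg1 t).trans ht
    _ = ε := ENNReal.add_thirds ε

end Basic

/-! ### Mollification in `L²`. -/

section Mollify

open scoped Convolution
open ContinuousLinearMap (lsmul)

variable {n : ℕ}

/-- The kernel is a probability density, so the mollification error is an average of the differences
`w (x - t) - w x` over `t` in its support; Jensen and Tonelli finish. Strong measurability of `w`
supplies the joint measurability in `(x, t)`. -/
lemma eLpNorm_mollify_sub_le_of_stronglyMeasurable {w : Eucl n → ℝ} (hw : MemLp w 2 volume)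
    (hwm : StronglyMeasurable w) (ρ : ContDiffBump (0 : Eucl n)) {ε : ℝ≥0∞}
    (hε : ∀ t : Eucl n, ‖t‖ ≤ ρ.rOut → eLpNorm (fun x => w (x + t) - w x) 2 volume ≤ ε) :
    eLpNorm (fun x => (ρ.normed volume ⋆[lsmul ℝ ℝ, volume] w) x - w x) 2 volume ≤ ε := by
  set k := ρ.normed (volume : Measure (Eucl n)) with hk
  have hkc : Continuous k := ρ.continuous_normed
  have hk0 : ∀ t, 0 ≤ k t := ρ.nonneg_normed
  have hki : Integrable k := ρ.integrable_normed
  set ν := (volume : Measure (Eucl n)).withDensity (fun t => ENNReal.ofReal (k t)) with hν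
  have hkm : Measurable fun t => ENNReal.ofReal (k t) := hkc.measurable.ennreal_ofReal
  have hprob : IsProbabilityMeasure ν := by
    constructor
    rw [hν, withDensity_apply _ MeasurableSet.univ, Measure.restrict_univ,
      ← ofReal_integral_eq_lintegral_ofReal hki (Eventually.of_forall hk0), hk, ρ.integral_normed,
      ENNReal.ofReal_one]
  have hwl : LocallyIntegrable w volume := hw.locallyIntegrable (by norm_num)
  have hpt : ∀ x, ‖(k ⋆[lsmul ℝ ℝ, volume] w) x - w x‖ₑ ≤ ∫⁻ t, ‖w (x - t) - w x‖ₑ ∂ν := by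
    intro x
    have h1 : Integrable (fun t => k t • w (x - t)) volume :=
      ((ρ.hasCompactSupport_normed).convolutionExists_left (lsmul ℝ ℝ) hkc hwl x)
    have h2 : Integrable (fun t => k t • w x) volume := hki.smul_const _
    have e : (k ⋆[lsmul ℝ ℝ, volume] w) x - w x = ∫ t, k t • (w (x - t) - w x) := by
      simp_rw [smul_sub]
      rw [integral_sub h1 h2, integral_smul_const, hk, ρ.integral_normed, one_smul]
      rfl
    rw [e]
    refine (enorm_integral_le_lintegral_enorm _).trans_eq ?_
    rw [hν, lintegral_withDensity_eq_lintegral_mul₀ hkm.aemeasurable]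
    · refine lintegral_congr fun t => ?_
      simp [enorm_mul, Real.enorm_eq_ofReal (hk0 t)]
    · exact ((hwm.comp_measurable (measurable_const.sub measurable_id)).sub
        stronglyMeasurable_const).enorm.aemeasurable
  have hjm : Measurable (fun p : Eucl n × Eucl n => ‖w (p.1 - p.2) - w p.1‖ₑ ^ 2) :=
    ((hwm.comp_measurable (measurable_fst.sub measurable_snd)).sub
      (hwm.comp_measurable measurable_fst)).enorm.pow_const _
  rw [← ENNReal.pow_le_pow_left_iff (n := 2) two_ne_zero, eLpNorm_two_sq]
  calc ∫⁻ x, ‖(k ⋆[lsmul ℝ ℝ, volume] w) x - w x‖ₑ ^ 2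
      ≤ ∫⁻ x, ∫⁻ t, ‖w (x - t) - w x‖ₑ ^ 2 ∂ν := by
        refine lintegral_mono fun x => ?_
        refine (pow_le_pow_left' (hpt x) 2).trans (sq_lintegral_le _ ?_)
        exact ((hwm.comp_measurable (measurable_const.sub measurable_id)).sub
          stronglyMeasurable_const).enorm.aemeasurable
    _ = ∫⁻ t, ∫⁻ x, ‖w (x - t) - w x‖ₑ ^ 2 ∂volume ∂ν :=
        lintegral_lintegral_swap hjm.aemeasurable
    _ = ∫⁻ t, ENNReal.ofReal (k t) * ∫⁻ x, ‖w (x - t) - w x‖ₑ ^ 2 := by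
        rw [hν, lintegral_withDensity_eq_lintegral_mul₀ hkm.aemeasurable]
        · rfl
        · exact (hjm.lintegral_prod_left').aemeasurable
    _ ≤ ∫⁻ t, ENNReal.ofReal (k t) * ε ^ 2 := by
        refine lintegral_mono fun t => ?_
        by_cases ht : ‖t‖ ≤ ρ.rOut
        · gcongr
          have := hε (-t) (by simpa using ht)
          rw [← ENNReal.pow_le_pow_left_iff (n := 2) two_ne_zero, eLpNorm_two_sq] at this
          simpa [sub_eq_add_neg] using this
        · have : k t = 0 := by
            have : t ∉ Function.support k := by
              rw [hk, ρ.support_normed_eq]; simp; linarith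
            simpa using this
          simp [this]
    _ = ε ^ 2 := by
        rw [lintegral_mul_const _ hkm, ← ofReal_integral_eq_lintegral_ofReal hki
          (Eventually.of_forall hk0), hk, ρ.integral_normed, ENNReal.ofReal_one, one_mul]

lemma eLpNorm_mollify_sub_le {w : Eucl n → ℝ} (hw : MemLp w 2 volume)
    (ρ : ContDiffBump (0 : Eucl n)) {ε : ℝ≥0∞}
    (hε : ∀ t : Eucl n, ‖t‖ ≤ ρ.rOut → eLpNorm (fun x => w (x + t) - w x) 2 volume ≤ ε) :
    eLpNorm (fun x => (ρ.normed volume ⋆[lsmul ℝ ℝ, volume] w) x - w x) 2 volume ≤ ε := by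
  set w' := hw.1.mk w with hw'
  have hae : w =ᵐ[volume] w' := hw.1.ae_eq_mk
  have hconv : ρ.normed volume ⋆[lsmul ℝ ℝ, volume] w
      = ρ.normed volume ⋆[lsmul ℝ ℝ, volume] w' :=
    convolution_congr _ (ae_eq_refl _) hae
  rw [hconv]
  have := eLpNorm_mollify_sub_le_of_stronglyMeasurable (hw.ae_eq hae)
    hw.1.stronglyMeasurable_mk ρ (ε := ε) (fun t ht => by
      refine (eLpNorm_congr_ae ?_).trans_le (hε t ht)
      have h2 := (measurePreserving_add_right (volume : Measure (Eucl n)) t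
        ).quasiMeasurePreserving.ae_eq hae
      filter_upwards [hae, h2] with x h1 h2
      simp only [Function.comp_apply] at h2
      rw [h1, h2])
  refine (eLpNorm_congr_ae ?_).trans_le this
  filter_upwards [hae] with x h1
  rw [h1]

/-- The standard bump functions with radii shrinking to `0`. -/
def shrinkingBump (n : ℕ) (k : ℕ) : ContDiffBump (0 : Eucl n) where
  rIn := 1 / (2 * (k + 1))
  rOut := 1 / (k + 1)
  rIn_pos := by positivity
  rIn_lt_rOut := by
    have : (0 : ℝ) < k + 1 := by positivity
    exact one_div_lt_one_div_of_lt this (by linarith)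

lemma tendsto_shrinkingBump_rOut (n : ℕ) :
    Tendsto (fun k => (shrinkingBump n k).rOut) atTop (𝓝 0) :=
  tendsto_one_div_add_atTop_nhds_zero_nat

/-- The mollifications of `w`. -/
def mollify (w : Eucl n → ℝ) (k : ℕ) : Eucl n → ℝ :=
  (shrinkingBump n k).normed volume ⋆[lsmul ℝ ℝ, volume] w

lemma tendsto_eLpNorm_mollify_sub {w : Eucl n → ℝ} (hw : MemLp w 2 volume) :
    Tendsto (fun k => eLpNorm (fun x => w x - mollify w k x) 2 volume) atTop (𝓝 0) := by
  rw [ENNReal.tendsto_nhds_zero]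
  intro ε hε
  have h := (ENNReal.tendsto_nhds_zero.1 (tendsto_eLpNorm_translate_sub hw)) ε hε
  obtain ⟨δ, hδ, hball⟩ := Metric.eventually_nhds_iff.1 h
  filter_upwards [(tendsto_shrinkingBump_rOut n).eventually (gt_mem_nhds hδ)] with k hk
  rw [eLpNorm_congr_norm_ae (g := fun x => mollify w k x - w x)
    (Eventually.of_forall fun x => norm_sub_rev _ _)]
  refine eLpNorm_mollify_sub_le hw _ fun t ht => hball ?_
  rw [dist_zero_right]
  exact ht.trans_lt hk

lemma contDiff_mollify {w : Eucl n → ℝ} (hw : MemLp w 2 volume) (k : ℕ) :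
    ContDiff ℝ ∞ (mollify w k) :=
  (shrinkingBump n k).hasCompactSupport_normed.contDiff_convolution_left _
    (shrinkingBump n k).contDiff_normed (hw.locallyIntegrable (by norm_num))

lemma tsupport_mollify_subset {w : Eucl n → ℝ} {K : Set (Eucl n)}
    (hw : ∀ x ∉ K, w x = 0) (k : ℕ) :
    tsupport (mollify w k) ⊆ Metric.cthickening (shrinkingBump n k).rOut K := by
  refine closure_minimal ?_ Metric.isClosed_cthickening
  refine (support_convolution_subset _).trans ?_
  rw [(shrinkingBump n k).support_normed_eq]
  rintro _ ⟨a, ha, b, hb, rfl⟩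
  have hbK : b ∈ K := by
    by_contra h; exact hb (hw b h)
  refine Metric.mem_cthickening_of_dist_le _ b _ _ hbK ?_
  simp only [dist_add_self_left]
  exact (mem_ball_zero_iff.1 ha).le

/-- The derivative falls on the kernel, and `y ↦ κ (x - y)` is then used as test function in the
weak gradient identity; the reflection accounts for the sign. Its support may lie anywhere, so the
identity is required on the whole space. -/
lemma gradient_mollify {w : Eucl n → ℝ} {g : Eucl n → Eucl n} (hw : MemLp w 2 volume)
    (hg : ∀ φ : Eucl n → ℝ, ContDiff ℝ ∞ φ → HasCompactSupport φ → ∀ i : Fin n,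
      ∫ x, w x * gradient φ x i = -∫ x, g x i * φ x) (k : ℕ) (x : Eucl n) (i : Fin n) :
    gradient (mollify w k) x i = mollify (fun y => g y i) k x := by
  set κ := (shrinkingBump n k).normed (volume : Measure (Eucl n)) with hκ
  have hκd : ContDiff ℝ ∞ κ := (shrinkingBump n k).contDiff_normed
  have hκc : HasCompactSupport κ := (shrinkingBump n k).hasCompactSupport_normed
  have hwl : LocallyIntegrable w volume := hw.locallyIntegrable (by norm_num)
  rw [gradient_apply, mollify, (hκc.hasFDerivAt_convolution_left (lsmul ℝ ℝ)
    (hκd.of_le (by simp)) hwl x).fderiv]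
  set φ : Eucl n → ℝ := fun y => κ (x - y) with hφ
  have hφd : ContDiff ℝ ∞ φ := hκd.comp (contDiff_const.sub contDiff_id)
  have hφc : HasCompactSupport φ := hκc.comp_homeomorph (Homeomorph.subLeft x)
  have hgφ : ∀ y, gradient φ y i = - fderiv ℝ κ (x - y) (EuclideanSpace.single i 1) := by
    intro y
    rw [gradient_apply]
    have h1 : HasFDerivAt (fun y : Eucl n => x - y) (-ContinuousLinearMap.id ℝ (Eucl n)) y :=
      (hasFDerivAt_id y).const_sub x
    have h2 := ((hκd.differentiable (by simp)) (x - y)).hasFDerivAt.comp y h1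
    change fderiv ℝ (κ ∘ fun y => x - y) y _ = _
    rw [h2.fderiv]; simp
  have hex : ConvolutionExistsAt (fderiv ℝ κ) w x ((lsmul ℝ ℝ).precompL (Eucl n)) volume :=
    (hκc.fderiv ℝ).convolutionExists_left _ (hκd.continuous_fderiv (by simp)) hwl x
  have key := hg φ hφd hφc i
  rw [mollify, convolution_eq_swap, convolution_eq_swap, ContinuousLinearMap.integral_apply]
  · simp only [hgφ, mul_neg, integral_neg, neg_inj] at key
    simp only [ContinuousLinearMap.precompL_apply, ContinuousLinearMap.lsmul_apply, smul_eq_mul]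
    rw [← hκ]
    simp_rw [mul_comm (κ _)]
    rw [← key]
    congr 1; ext y; ring
  · have := hex.integrable_swap
    exact this

end Mollify

/-! ### Products with test functions and membership in `H¹₀`. -/

section Product

variable {n : ℕ}

lemma memLp_coord {μ : Measure (Eucl n)} {g : Eucl n → Eucl n} (hg : MemLp g 2 μ) (i : Fin n) :
    MemLp (fun x => g x i) 2 μ :=
  (EuclideanSpace.proj (𝕜 := ℝ) i).comp_memLp' hg

lemma norm_le_sum_coord (x : Eucl n) : ‖x‖ ≤ ∑ i, ‖x i‖ := by
  have : x = ∑ i, EuclideanSpace.single i (x i) := by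
    ext j; simp [Finset.sum_apply, Pi.single_apply]
  conv_lhs => rw [this]
  refine (norm_sum_le _ _).trans (le_of_eq ?_)
  simp

lemma eLpNorm_le_sum_coord {μ : Measure (Eucl n)} {g : Eucl n → Eucl n}
    (hg : AEStronglyMeasurable g μ) :
    eLpNorm g 2 μ ≤ ∑ i, eLpNorm (fun x => g x i) 2 μ := by
  calc eLpNorm g 2 μ ≤ eLpNorm (fun x => ∑ i, ‖g x i‖) 2 μ :=
        eLpNorm_mono_real fun x => norm_le_sum_coord _
    _ = eLpNorm (∑ i, fun x => ‖g x i‖) 2 μ := by congr 1; ext x; simp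
    _ ≤ ∑ i, eLpNorm (fun x => ‖g x i‖) 2 μ :=
        eLpNorm_sum_le (fun i _ =>
          ((EuclideanSpace.proj (𝕜 := ℝ) i).continuous.comp_aestronglyMeasurable hg).norm)
          (by norm_num)
    _ = _ := by simp only [eLpNorm_norm]

lemma memLp_smul_of_bound {α E : Type*} [MeasurableSpace α] [NormedAddCommGroup E]
    [NormedSpace ℝ E] {μ : Measure α} {b : α → ℝ} {f : α → E} {C : ℝ}
    (hb : AEStronglyMeasurable b μ) (hC : ∀ᵐ x ∂μ, |b x| ≤ C) (hf : MemLp f 2 μ) :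
    MemLp (fun x => b x • f x) 2 μ := by
  refine hf.of_le_mul (c := C) (hb.smul hf.1) ?_
  filter_upwards [hC] with x hx
  rw [norm_smul]
  exact mul_le_mul_of_nonneg_right hx (norm_nonneg _)

lemma memLp_of_continuous_hasCompactSupport {E : Type*} [NormedAddCommGroup E]
    {f : Eucl n → E} (hf : Continuous f)
    (hc : HasCompactSupport f) (Ω : Set (Eucl n)) : MemLp f 2 (volume.restrict Ω) :=
  (hf.memLp_of_hasCompactSupport hc).restrict Ω

lemma IsTestFunction.contDiff_one {Ω : Set (Eucl n)} {φ : Eucl n → ℝ} (hφ : IsTestFunction Ω φ) :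
    ContDiff ℝ 1 φ := hφ.1.of_le (by simp)

lemma IsTestFunction.differentiable {Ω : Set (Eucl n)} {φ : Eucl n → ℝ}
    (hφ : IsTestFunction Ω φ) : Differentiable ℝ φ := hφ.1.differentiable (by simp)

lemma IsTestFunction.continuous_gradient {Ω : Set (Eucl n)} {φ : Eucl n → ℝ}
    (hφ : IsTestFunction Ω φ) : Continuous (gradient φ) :=
  DeGiorgi.continuous_gradient hφ.contDiff_one

lemma IsTestFunction.memLp {Ω : Set (Eucl n)} {φ : Eucl n → ℝ} (hφ : IsTestFunction Ω φ)
    (U : Set (Eucl n)) : MemLp φ 2 (volume.restrict U) :=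
  memLp_of_continuous_hasCompactSupport hφ.1.continuous hφ.2.1 U

lemma IsTestFunction.memLp_gradient {Ω : Set (Eucl n)} {φ : Eucl n → ℝ}
    (hφ : IsTestFunction Ω φ) (U : Set (Eucl n)) : MemLp (gradient φ) 2 (volume.restrict U) :=
  memLp_of_continuous_hasCompactSupport hφ.continuous_gradient
    (hasCompactSupport_gradient hφ.2.1) U

lemma IsTestFunction.mono {Ω U : Set (Eucl n)} {φ : Eucl n → ℝ}
    (hφ : IsTestFunction Ω φ) (h : Ω ⊆ U) : IsTestFunction U φ :=
  ⟨hφ.1, hφ.2.1, hφ.2.2.trans h⟩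

lemma IsTestFunction.eq_zero {Ω : Set (Eucl n)} {φ : Eucl n → ℝ}
    (hφ : IsTestFunction Ω φ) {x : Eucl n} (hx : x ∉ Ω) : φ x = 0 :=
  image_eq_zero_of_notMem_tsupport fun h => hx (hφ.2.2 h)

lemma IsTestFunction.gradient_eq_zero {Ω : Set (Eucl n)} {φ : Eucl n → ℝ}
    (hφ : IsTestFunction Ω φ) {x : Eucl n} (hx : x ∉ Ω) : gradient φ x = 0 :=
  gradient_eq_zero_of_notMem fun h => hx (hφ.2.2 h)

lemma exists_bound_of_hasCompactSupport {E : Type*} [NormedAddCommGroup E] {f : Eucl n → E}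
    (hf : Continuous f) (hc : HasCompactSupport f) : ∃ C, ∀ x, ‖f x‖ ≤ C :=
  hc.exists_bound_of_continuous hf

/-- The mollifications are the approximating test functions: once the kernel radius is small, their
supports stay in a compact thickening of `K` inside `Ω`. -/
lemma inH10_of_isCompact {Ω K : Set (Eucl n)} (hΩ : IsOpen Ω) (hK : IsCompact K) (hKΩ : K ⊆ Ω)
    {w : Eucl n → ℝ} {g : Eucl n → Eucl n} (hw : MemLp w 2 volume) (hg : MemLp g 2 volume)
    (hw0 : ∀ x ∉ K, w x = 0)
    (hwg : ∀ φ : Eucl n → ℝ, ContDiff ℝ ∞ φ → HasCompactSupport φ → ∀ i : Fin n,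
      ∫ x, w x * gradient φ x i = -∫ x, g x i * φ x) : InH10 Ω w g := by
  refine ⟨⟨hw.restrict Ω, hg.restrict Ω, fun φ hφ i => ?_⟩, ?_⟩
  · rw [setIntegral_eq_integral_of_forall_compl_eq_zero,
      setIntegral_eq_integral_of_forall_compl_eq_zero]
    · exact hwg φ hφ.1 hφ.2.1 i
    · intro x hx; rw [hφ.eq_zero hx, mul_zero]
    · intro x hx; rw [hφ.gradient_eq_zero hx]; simp
  obtain ⟨δ, hδ, hδK⟩ := hK.exists_cthickening_subset_open hΩ hKΩ
  obtain ⟨N, hN⟩ := eventually_atTop.1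
    ((tendsto_shrinkingBump_rOut n).eventually (gt_mem_nhds hδ))
  -- The shift by `N` discards the kernels that are too wide, since every member of the sequence
  -- must be a test function in `Ω`.
  have hshift : Tendsto (fun k => k + N) atTop atTop := tendsto_add_atTop_nat N
  refine ⟨fun k => mollify w (k + N), fun k => ?_, ?_, ?_⟩
  · have hsub := tsupport_mollify_subset hw0 (k + N)
    refine ⟨contDiff_mollify hw _, ?_, hsub.trans ?_⟩
    · exact (hK.cthickening).of_isClosed_subset (isClosed_tsupport _) hsub
    · exact (Metric.cthickening_mono (hN _ (Nat.le_add_left _ _)).le K).trans hδK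
  · refine tendsto_of_tendsto_of_tendsto_of_le_of_le tendsto_const_nhds
      ((tendsto_eLpNorm_mollify_sub hw).comp hshift) (fun k => zero_le) fun k => ?_
    exact eLpNorm_mono_measure _ Measure.restrict_le_self
  · have hlim : Tendsto (fun k => ∑ i, eLpNorm (fun x => g x i - mollify (fun y => g y i) (k + N) x)
        2 volume) atTop (𝓝 0) := by
      have := tendsto_finsetSum (Finset.univ : Finset (Fin n)) fun i _ =>
        (tendsto_eLpNorm_mollify_sub (memLp_coord hg i)).comp hshift
      simpa using this
    refine tendsto_of_tendsto_of_tendsto_of_le_of_le tendsto_const_nhds hlim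
      (fun k => zero_le) fun k => ?_
    have hm : AEStronglyMeasurable (fun x => g x - gradient (mollify w (k + N)) x) volume :=
      hg.1.sub (continuous_gradient
        ((contDiff_mollify hw _).of_le (by simp))).aestronglyMeasurable
    refine (eLpNorm_mono_measure _ Measure.restrict_le_self).trans
      ((eLpNorm_le_sum_coord hm).trans (le_of_eq ?_))
    refine Finset.sum_congr rfl fun i _ => ?_
    simp only [PiLp.sub_apply, gradient_mollify hw hwg]

lemma memLp_of_restrict {E : Type*} [NormedAddCommGroup E] {Ω : Set (Eucl n)}
    (hΩ : MeasurableSet Ω) {f : Eucl n → E} (hf : MemLp f 2 (volume.restrict Ω))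
    (h0 : ∀ x ∉ Ω, f x = 0) : MemLp f 2 volume := by
  have : Ω.indicator f = f := Set.indicator_eq_self.2 fun x hx => by
    by_contra h; exact hx (h0 x h)
  rw [← this]
  exact (memLp_indicator_iff_restrict hΩ).2 hf

lemma IsTestFunction.mul_contDiff {Ω : Set (Eucl n)} {η φ : Eucl n → ℝ} (hη : IsTestFunction Ω η)
    (hφ : ContDiff ℝ ∞ φ) : IsTestFunction Ω (fun x => η x * φ x) :=
  ⟨hη.1.mul hφ, hη.2.1.mul_right, (tsupport_mul_subset_left (f := η) (g := φ)).trans hη.2.2⟩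

/-- The product of an `H¹` function with a test function is in `H¹₀`. -/
lemma InH1.testFunction_mul {Ω : Set (Eucl n)} (hΩ : IsOpen Ω) {u : Eucl n → ℝ}
    {g : Eucl n → Eucl n} (hu : InH1 Ω u g) {η : Eucl n → ℝ} (hη : IsTestFunction Ω η) :
    InH10 Ω (fun x => η x * u x) (fun x => η x • g x + u x • gradient η x) := by
  obtain ⟨hu2, hg2, hug⟩ := hu
  obtain ⟨C, hC⟩ := exists_bound_of_hasCompactSupport hη.1.continuous hη.2.1
  obtain ⟨D, hD⟩ := exists_bound_of_hasCompactSupport hη.continuous_gradient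
    (hasCompactSupport_gradient hη.2.1)
  have hηm : AEStronglyMeasurable η (volume.restrict Ω) := hη.1.continuous.aestronglyMeasurable
  have hw : MemLp (fun x => η x * u x) 2 (volume.restrict Ω) :=
    memLp_smul_of_bound hηm (Eventually.of_forall hC) hu2
  have hηg : MemLp (fun x => η x • g x) 2 (volume.restrict Ω) :=
    memLp_smul_of_bound hηm (Eventually.of_forall hC) hg2
  have hgη : MemLp (fun x => u x • gradient η x) 2 (volume.restrict Ω) := by
    refine hu2.of_le_mul (c := D)
      (hu2.1.smul hη.continuous_gradient.aestronglyMeasurable) (Eventually.of_forall fun x => ?_)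
    rw [norm_smul, mul_comm]
    exact mul_le_mul_of_nonneg_right (hD x) (norm_nonneg _)
  have hw0 : ∀ x ∉ tsupport η, η x * u x = 0 := fun x hx => by
    rw [image_eq_zero_of_notMem_tsupport hx, zero_mul]
  have hh0 : ∀ x ∉ tsupport η, η x • g x + u x • gradient η x = 0 := fun x hx => by
    rw [image_eq_zero_of_notMem_tsupport hx, gradient_eq_zero_of_notMem hx]; simp
  refine inH10_of_isCompact hΩ hη.2.1 hη.2.2
    (memLp_of_restrict hΩ.measurableSet hw fun x hx => hw0 x fun h => hx (hη.2.2 h))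
    (memLp_of_restrict hΩ.measurableSet (hηg.add hgη) fun x hx => hh0 x fun h => hx (hη.2.2 h))
    hw0 fun φ hφ hφc i => ?_
  have hφ1 : ContDiff ℝ 1 φ := hφ.of_le (by simp)
  have hφ2 : MemLp φ 2 (volume.restrict Ω) :=
    memLp_of_continuous_hasCompactSupport hφ.continuous hφc Ω
  have hdφ2 : MemLp (fun x => gradient φ x i) 2 (volume.restrict Ω) :=
    memLp_coord (memLp_of_continuous_hasCompactSupport (continuous_gradient hφ1)
      (hasCompactSupport_gradient hφc) Ω) i
  -- The product rule for weak gradients: test `u` with `η φ` and move the term containing `∇η` to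
  -- the other side.
  have key := hug _ (hη.mul_contDiff hφ) i
  have hgrad : ∀ x, gradient (fun y => η y * φ y) x i
      = η x * gradient φ x i + φ x * gradient η x i := fun x => by
    rw [gradient_mul (hη.differentiable x) (hφ1.differentiable one_ne_zero x)]; simp
  have i1 : Integrable (fun x => η x * u x * gradient φ x i) (volume.restrict Ω) :=
    hw.integrable_mul hdφ2
  have i2 : Integrable (fun x => u x * gradient η x i * φ x) (volume.restrict Ω) := by
    have := (memLp_coord hgη i).integrable_mul hφ2
    exact this
  have i3 : Integrable (fun x => η x * g x i * φ x) (volume.restrict Ω) := by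
    have := (memLp_coord hηg i).integrable_mul hφ2
    exact this
  have e1 : ∫ x in Ω, u x * gradient (fun y => η y * φ y) x i
      = (∫ x in Ω, η x * u x * gradient φ x i) + ∫ x in Ω, u x * gradient η x i * φ x := by
    rw [← integral_add i1 i2]
    congr 1; ext x; rw [hgrad]; ring
  have e2 : ∫ x in Ω, (η x • g x + u x • gradient η x) i * φ x
      = (∫ x in Ω, η x * g x i * φ x) + ∫ x in Ω, u x * gradient η x i * φ x := by
    rw [← integral_add i3 i2]
    congr 1; ext x; simp; ring
  have e3 : ∫ x in Ω, g x i * (η x * φ x) = ∫ x in Ω, η x * g x i * φ x := by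
    congr 1; ext x; ring
  rw [← setIntegral_eq_integral_of_forall_compl_eq_zero (s := Ω),
    ← setIntegral_eq_integral_of_forall_compl_eq_zero (s := Ω) (μ := volume)
      (f := fun x => (η x • g x + u x • gradient η x) i * φ x), e2]
  · rw [e1, e3] at key
    linarith
  · intro x hx; rw [hh0 x fun h => hx (hη.2.2 h)]; simp
  · intro x hx; rw [hw0 x fun h => hx (hη.2.2 h), zero_mul]

end Product

/-! ### Limits of integrals of triple products. -/

section Limits

lemma tendsto_eLpNorm_mul_sub {α : Type*} [MeasurableSpace α] {μ : Measure α} {b : ℕ → α → ℝ}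
    {f : ℕ → α → ℝ} {g ψ : α → ℝ} {M : ℝ} (hb : ∀ k, AEStronglyMeasurable (b k) μ)
    (hM : ∀ k x, |b k x| ≤ M) (hf : ∀ k, MemLp (f k) 2 μ) (hg : MemLp g 2 μ) (hψ : MemLp ψ 2 μ)
    (hlim : Tendsto (fun k => eLpNorm (fun x => g x - f k x) 2 μ) atTop (𝓝 0)) :
    Tendsto (fun k => eLpNorm (fun x => b k x * (f k x - g x) * ψ x) 1 μ) atTop (𝓝 0) := by
  have hup : Tendsto (fun k => ENNReal.ofReal M * (eLpNorm (fun x => g x - f k x) 2 μ)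
      * eLpNorm ψ 2 μ) atTop (𝓝 0) := by
    have h1 := ENNReal.Tendsto.const_mul hlim (Or.inr (ENNReal.ofReal_ne_top (r := M)))
    have h2 := ENNReal.Tendsto.mul_const h1 (Or.inr hψ.2.ne)
    simpa using h2
  refine tendsto_of_tendsto_of_tendsto_of_le_of_le tendsto_const_nhds hup
    (fun k => zero_le) fun k => ?_
  have h1 : eLpNorm (fun x => b k x * (f k x - g x)) 2 μ
      ≤ ENNReal.ofReal M * eLpNorm (fun x => g x - f k x) 2 μ := by
    refine eLpNorm_le_mul_eLpNorm_of_ae_le_mul (Eventually.of_forall fun x => ?_) 2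
    rw [norm_mul, norm_sub_rev]
    exact mul_le_mul_of_nonneg_right (hM k x) (norm_nonneg _)
  have h2 := eLpNorm_smul_le_mul_eLpNorm (p := 2) (q := 2) (r := 1) hψ.1
    ((hb k).mul ((hf k).1.sub hg.1))
  refine le_trans ?_ (mul_le_mul_left h1 _)
  exact h2

/-- Passage to the limit in a product of a bounded a.e. convergent sequence, an `L²` convergent
sequence and a fixed `L²` function. -/
lemma tendsto_integral_mul_mul {α : Type*} [MeasurableSpace α] {μ : Measure α} {b : ℕ → α → ℝ}
    {f : ℕ → α → ℝ} {c g ψ : α → ℝ} {M : ℝ} (hb : ∀ k, AEStronglyMeasurable (b k) μ)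
    (hM : ∀ k x, |b k x| ≤ M) (hbc : ∀ᵐ x ∂μ, Tendsto (fun k => b k x) atTop (𝓝 (c x)))
    (hf : ∀ k, MemLp (f k) 2 μ) (hg : MemLp g 2 μ) (hψ : MemLp ψ 2 μ)
    (hlim : Tendsto (fun k => eLpNorm (fun x => g x - f k x) 2 μ) atTop (𝓝 0)) :
    Tendsto (fun k => ∫ x, b k x * f k x * ψ x ∂μ) atTop (𝓝 (∫ x, c x * g x * ψ x ∂μ)) := by
  have hint : ∀ k, ∀ f' : α → ℝ, MemLp f' 2 μ → Integrable (fun x => b k x * f' x * ψ x) μ :=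
    fun k f' hf' => (memLp_smul_of_bound (hb k) (Eventually.of_forall (hM k)) hf').integrable_mul hψ
  have h1 : Tendsto (fun k => ∫ x, b k x * g x * ψ x ∂μ) atTop (𝓝 (∫ x, c x * g x * ψ x ∂μ)) := by
    refine tendsto_integral_of_dominated_convergence (fun x => M * |g x * ψ x|)
      (fun k => (hint k g hg).1) ((hg.integrable_mul hψ).abs.const_mul M) (fun k => ?_) ?_
    · refine Eventually.of_forall fun x => ?_
      rw [mul_assoc, norm_mul]
      exact mul_le_mul_of_nonneg_right (hM k x) (norm_nonneg _)
    · filter_upwards [hbc] with x hx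
      exact (hx.mul_const _).mul_const _
  have h2 : Tendsto (fun k => ∫ x, b k x * (f k x - g x) * ψ x ∂μ) atTop (𝓝 0) := by
    have := tendsto_integral_of_L1' (μ := μ) (fun _ : α => (0 : ℝ)) aestronglyMeasurable_const
      (F := fun k x => b k x * (f k x - g x) * ψ x) (l := atTop)
      (Eventually.of_forall fun k => hint k _ ((hf k).sub hg)) (by
        have := tendsto_eLpNorm_mul_sub hb hM hf hg hψ hlim
        refine this.congr fun k => ?_
        congr 1; ext x; simp)
    simpa using this
  have h3 := h1.add h2
  rw [add_zero] at h3
  refine h3.congr fun k => ?_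
  have h4 : Integrable (fun x => b k x * (f k x - g x) * ψ x) μ := hint k _ ((hf k).sub hg)
  rw [← integral_add (hint k g hg) h4]
  congr 1; ext x; ring

end Limits

/-! ### Chain rule and uniqueness for weak gradients. -/

section Chain

variable {n : ℕ} {Ω : Set (Eucl n)}

/-- Passing to a subsequence adds a.e. convergence, which is needed to pass to the limit in
nonlinear factors such as `deriv F (φ k x)`. -/
lemma InH10.exists_seq {v : Eucl n → ℝ} {h : Eucl n → Eucl n} (hv : InH10 Ω v h) :
    ∃ φ : ℕ → Eucl n → ℝ, (∀ k, IsTestFunction Ω (φ k)) ∧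
      Tendsto (fun k => eLpNorm (fun x => v x - φ k x) 2 (volume.restrict Ω)) atTop (𝓝 0) ∧
      (∀ i, Tendsto (fun k => eLpNorm (fun x => h x i - gradient (φ k) x i) 2
        (volume.restrict Ω)) atTop (𝓝 0)) ∧
      ∀ᵐ x ∂(volume.restrict Ω), Tendsto (fun k => φ k x) atTop (𝓝 (v x)) := by
  obtain ⟨⟨hv2, hh2, -⟩, φ, hφ, h1, h2⟩ := hv
  have hm : TendstoInMeasure (volume.restrict Ω) φ atTop v := by
    refine tendstoInMeasure_of_tendsto_eLpNorm (p := 2) (by norm_num)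
      (fun k => ((hφ k).memLp Ω).1) hv2.1 (h1.congr fun k => ?_)
    exact eLpNorm_congr_norm_ae (Eventually.of_forall fun x => norm_sub_rev _ _)
  obtain ⟨ns, hns, hae⟩ := hm.exists_seq_tendsto_ae
  refine ⟨fun k => φ (ns k), fun k => hφ _, h1.comp hns.tendsto_atTop, fun i => ?_, hae⟩
  refine tendsto_of_tendsto_of_tendsto_of_le_of_le tendsto_const_nhds
    (h2.comp hns.tendsto_atTop) (fun k => zero_le) fun k => ?_
  refine eLpNorm_mono fun x => ?_
  exact PiLp.norm_apply_le (h x - gradient (φ (ns k)) x) i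

lemma integral_testFunction_comp {U : Set (Eucl n)} {F : ℝ → ℝ} (hF : ContDiff ℝ 1 F)
    {f φ : Eucl n → ℝ} (hf : IsTestFunction U f)
    (hφ : IsTestFunction Ω φ) (i : Fin n) :
    ∫ x in Ω, F (f x) * gradient φ x i
      = -∫ x in Ω, deriv F (f x) * gradient f x i * φ x := by
  have hFf : ContDiff ℝ 1 (fun x => F (f x)) := hF.comp hf.contDiff_one
  have hgF : ∀ x, gradient (fun x => F (f x)) x i = deriv F (f x) * gradient f x i := fun x => by
    rw [gradient_comp ((hF.differentiable one_ne_zero) _) (hf.differentiable x)]; simp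
  have c1 := (EuclideanSpace.proj (𝕜 := ℝ) i).continuous.comp (continuous_gradient hFf)
  have c2 := (EuclideanSpace.proj (𝕜 := ℝ) i).continuous.comp hφ.continuous_gradient
  have s2 : HasCompactSupport fun x => gradient φ x i :=
    (hasCompactSupport_gradient hφ.2.1).comp_left (g := fun y : Eucl n => y i) rfl
  have hφc := hφ.1.continuous
  rw [setIntegral_eq_integral_of_forall_compl_eq_zero,
    setIntegral_eq_integral_of_forall_compl_eq_zero]
  · simp_rw [← hgF, gradient_apply]
    refine integral_mul_fderiv_eq_neg_fderiv_mul_of_integrable ?_ ?_ ?_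
      (fun x _ => hFf.differentiable one_ne_zero x) (fun x _ => hφ.differentiable x)
    · simp_rw [← gradient_apply]
      exact (c1.mul hφc).integrable_of_hasCompactSupport hφ.2.1.mul_left
    · simp_rw [← gradient_apply]
      exact (hFf.continuous.mul c2).integrable_of_hasCompactSupport s2.mul_left
    · exact (hFf.continuous.mul hφc).integrable_of_hasCompactSupport hφ.2.1.mul_left
  · intro x hx; rw [hφ.eq_zero hx, mul_zero]
  · intro x hx; rw [hφ.gradient_eq_zero hx]; simp

open scoped Manifold in
lemma IsTestFunction.exists_cutoff (hΩ : IsOpen Ω) {K : Set (Eucl n)} (hK : IsCompact K)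
    (hKΩ : K ⊆ Ω) : ∃ η : Eucl n → ℝ, IsTestFunction Ω η ∧ (∀ x, η x ∈ Set.Icc (0 : ℝ) 1) ∧
      ∀ x ∈ K, η x = 1 ∧ gradient η x = 0 := by
  obtain ⟨L, hL, hKL, hLΩ⟩ := exists_compact_between hK hΩ hKΩ
  obtain ⟨f, hf1, hf0, hf⟩ := exists_contMDiffMap_one_nhds_of_subset_interior (n := ⊤)
    𝓘(ℝ, Eucl n) hK.isClosed hKL
  have hsub : tsupport f ⊆ L := closure_minimal (fun x hx => by
    by_contra h; exact hx (hf0 x h)) hL.isClosed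
  refine ⟨f, ⟨f.contMDiff.contDiff, hL.of_isClosed_subset (isClosed_tsupport _) hsub,
    hsub.trans hLΩ⟩, hf, fun x hx => ?_⟩
  have hev := (Filter.eventually_iff.1 hf1)
  have h1 : ∀ᶠ y in 𝓝 x, f y = 1 := (mem_nhdsSet_iff_forall.1 hev) x hx
  refine ⟨h1.self_of_nhds, ?_⟩
  have h2 : f =ᶠ[𝓝 x] fun _ => (1 : ℝ) := h1
  ext i
  rw [gradient_apply, h2.fderiv_eq]
  simp

/-- The mean value inequality gives `|F (u x) - F 0| ≤ M |u x|`; finiteness of the measure takes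
care of the constant `F 0`. -/
lemma memLp_comp_of_deriv_bound [IsFiniteMeasure (volume.restrict Ω)] {u : Eucl n → ℝ}
    (hu : MemLp u 2 (volume.restrict Ω)) {F : ℝ → ℝ} (hF : ContDiff ℝ 1 F) {M : ℝ}
    (hM : ∀ t, |deriv F t| ≤ M) : MemLp (fun x => F (u x)) 2 (volume.restrict Ω) := by
  have h0 : MemLp (fun x => F (u x) - F 0) 2 (volume.restrict Ω) := by
    refine hu.of_le_mul (c := M) ((hF.continuous.comp_aestronglyMeasurable hu.1).sub
      aestronglyMeasurable_const) (Eventually.of_forall fun x => ?_)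
    have := Convex.norm_image_sub_le_of_norm_deriv_le (f := F) (s := Set.univ) (x := 0) (y := u x)
      (C := M) (fun t _ => hF.differentiable one_ne_zero t) (fun t _ => hM t) convex_univ
      trivial trivial
    simpa using this
  have := h0.add (memLp_const (F 0))
  refine this.ae_eq (Eventually.of_forall fun x => ?_)
  simp

/-- Chain rule for weak gradients. -/
lemma InH1.comp [IsFiniteMeasure (volume.restrict Ω)] (hΩ : IsOpen Ω) {u : Eucl n → ℝ}
    {g : Eucl n → Eucl n} (hu : InH1 Ω u g) {F : ℝ → ℝ} (hF : ContDiff ℝ 1 F) {M : ℝ}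
    (hM : ∀ t, |deriv F t| ≤ M) :
    InH1 Ω (fun x => F (u x)) (fun x => deriv F (u x) • g x) := by
  have hdc : Continuous (deriv F) := hF.continuous_deriv le_rfl
  refine ⟨memLp_comp_of_deriv_bound hu.1 hF hM, memLp_smul_of_bound
    (hdc.comp_aestronglyMeasurable hu.1.1) (Eventually.of_forall fun x => hM _) hu.2.1,
    fun φ hφ i => ?_⟩
  -- Approximation by test functions is available for `η u`, not for `u`. As `η = 1` and `∇η = 0` on
  -- the support of `φ`, replacing `u` by `η u` changes neither side of the identity.
  obtain ⟨η, hη, -, hη1⟩ := IsTestFunction.exists_cutoff hΩ hφ.2.1 hφ.2.2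
  have hηu := hu.testFunction_mul hΩ hη
  obtain ⟨f, hf, hf1, hf2, hfae⟩ := hηu.exists_seq
  have hφ2 := hφ.memLp Ω
  have hdφ2 := memLp_coord (hφ.memLp_gradient Ω) i
  have hL : Tendsto (fun k => ∫ x in Ω, F (f k x) * gradient φ x i) atTop
      (𝓝 (∫ x in Ω, F (η x * u x) * gradient φ x i)) := by
    have := tendsto_integral_mul_mul (μ := volume.restrict Ω) (b := fun _ _ => 1)
      (c := fun _ => 1) (M := 1) (f := fun k x => F (f k x)) (g := fun x => F (η x * u x))
      (ψ := fun x => gradient φ x i) (fun _ => aestronglyMeasurable_const) (by simp) (by simp)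
      (fun k => memLp_comp_of_deriv_bound ((hf k).memLp Ω) hF hM)
      (memLp_comp_of_deriv_bound hηu.1.1 hF hM) hdφ2 (by
        have hup := ENNReal.Tendsto.const_mul hf1 (Or.inr (ENNReal.ofReal_ne_top (r := M)))
        rw [mul_zero] at hup
        refine tendsto_of_tendsto_of_tendsto_of_le_of_le tendsto_const_nhds hup
          (fun k => zero_le) fun k => ?_
        refine eLpNorm_le_mul_eLpNorm_of_ae_le_mul (Eventually.of_forall fun x => ?_) 2
        exact Convex.norm_image_sub_le_of_norm_deriv_le (f := F) (s := Set.univ)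
          (fun t _ => hF.differentiable one_ne_zero t) (fun t _ => hM t) convex_univ
          trivial trivial)
    simpa using this
  have hR : Tendsto (fun k => ∫ x in Ω, deriv F (f k x) * gradient (f k) x i * φ x) atTop
      (𝓝 (∫ x in Ω, deriv F (η x * u x) * (η x • g x + u x • gradient η x) i * φ x)) := by
    refine tendsto_integral_mul_mul (M := M)
      (fun k => (hdc.comp (hf k).1.continuous).aestronglyMeasurable)
      (fun k x => hM _) ?_ (fun k => memLp_coord ((hf k).memLp_gradient Ω) i)
      (memLp_coord hηu.1.2.1 i) hφ2 (hf2 i)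
    filter_upwards [hfae] with x hx
    exact (hdc.tendsto _).comp hx
  have hlim := tendsto_nhds_unique hL (by
    refine hR.neg.congr fun k => ?_
    rw [integral_testFunction_comp hF (hf k) hφ i])
  calc ∫ x in Ω, F (u x) * gradient φ x i
      = ∫ x in Ω, F (η x * u x) * gradient φ x i := by
        congr 1; ext x
        by_cases hx : x ∈ tsupport φ
        · rw [(hη1 x hx).1, one_mul]
        · rw [gradient_eq_zero_of_notMem hx]; simp
    _ = _ := hlim
    _ = _ := by
        congr 2; ext x
        by_cases hx : x ∈ tsupport φ
        · rw [(hη1 x hx).1, (hη1 x hx).2, one_mul]; simp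
        · rw [image_eq_zero_of_notMem_tsupport hx]; simp

/-- The fundamental lemma of the calculus of variations, applied to each coordinate of `g - g'`. -/
lemma InH1.ae_eq (hΩ : IsOpen Ω) {u u' : Eucl n → ℝ} {g g' : Eucl n → Eucl n}
    (hu : InH1 Ω u g) (hu' : InH1 Ω u' g') (h : u =ᵐ[volume.restrict Ω] u') :
    g =ᵐ[volume.restrict Ω] g' := by
  have hi : ∀ i : Fin n, ∀ᵐ x ∂(volume.restrict Ω), g x i - g' x i = 0 := by
    intro i
    rw [ae_restrict_iff' hΩ.measurableSet]
    have h1 := memLp_coord hu.2.1 i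
    have h2 := memLp_coord hu'.2.1 i
    have hd : LocallyIntegrable (fun x => g x i - g' x i) (volume.restrict Ω) :=
      (h1.sub h2).locallyIntegrable (by norm_num)
    refine hΩ.ae_eq_zero_of_integral_contDiff_smul_eq_zero (f := fun x => g x i - g' x i)
      (locallyIntegrableOn_of_locallyIntegrable_restrict hd) fun φ hφ hφc hφΩ => ?_
    have hφt : IsTestFunction Ω φ := ⟨hφ, hφc, hφΩ⟩
    have e1 := hu.2.2 φ hφt i
    have e2 := hu'.2.2 φ hφt i
    have e3 : ∫ x in Ω, u x * gradient φ x i = ∫ x in Ω, u' x * gradient φ x i :=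
      integral_congr_ae (by filter_upwards [h] with x hx; rw [hx])
    rw [← setIntegral_eq_integral_of_forall_compl_eq_zero (s := Ω)
      (fun x hx => by rw [hφt.eq_zero hx, zero_smul])]
    have i1 : Integrable (fun x => g x i * φ x) (volume.restrict Ω) :=
      h1.integrable_mul (hφt.memLp Ω)
    have i2 : Integrable (fun x => g' x i * φ x) (volume.restrict Ω) :=
      h2.integrable_mul (hφt.memLp Ω)
    have : ∫ x in Ω, φ x • (g x i - g' x i)
        = (∫ x in Ω, g x i * φ x) - ∫ x in Ω, g' x i * φ x := by
      rw [← integral_sub i1 i2]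
      congr 1; ext x; rw [smul_eq_mul]; ring
    rw [this]; linarith
  filter_upwards [ae_all_iff.2 hi] with x hx
  ext i
  linarith [hx i]

end Chain

/-! ### Smooth approximations of absolute value, sign, Heaviside function and positive part. -/

section SmoothSign

/-- A smooth approximation of `|t|`. -/
def smoothAbs (ε t : ℝ) : ℝ := Real.sqrt (t ^ 2 + ε ^ 2)

/-- The derivative of `smoothAbs`, a smooth approximation of the sign. -/
def smoothSign (ε t : ℝ) : ℝ := t / Real.sqrt (t ^ 2 + ε ^ 2)

variable {ε : ℝ}

lemma smoothAbs_pos (hε : 0 < ε) (t : ℝ) : 0 < Real.sqrt (t ^ 2 + ε ^ 2) :=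
  Real.sqrt_pos.2 (by positivity)

lemma contDiff_smoothAbs (hε : 0 < ε) : ContDiff ℝ ∞ (smoothAbs ε) := by
  unfold smoothAbs
  exact ContDiff.sqrt (by fun_prop) fun t => by positivity

lemma contDiff_smoothSign (hε : 0 < ε) : ContDiff ℝ ∞ (smoothSign ε) :=
  contDiff_id.div (contDiff_smoothAbs hε) fun t => (smoothAbs_pos hε t).ne'

lemma hasDerivAt_smoothAbs (hε : 0 < ε) (t : ℝ) :
    HasDerivAt (smoothAbs ε) (smoothSign ε t) t := by
  have h1 : HasDerivAt (fun t : ℝ => t ^ 2 + ε ^ 2) (2 * t) t := by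
    simpa using (hasDerivAt_pow 2 t).add_const (ε ^ 2)
  have h2 := h1.sqrt (by positivity)
  refine HasDerivAt.congr_deriv (f := smoothAbs ε) h2 ?_
  unfold smoothSign
  field_simp

lemma hasDerivAt_smoothSign (hε : 0 < ε) (t : ℝ) :
    HasDerivAt (smoothSign ε) (ε ^ 2 / Real.sqrt (t ^ 2 + ε ^ 2) ^ 3) t := by
  have hp := smoothAbs_pos hε t
  have h2 := (hasDerivAt_id t).div (hasDerivAt_smoothAbs hε t) hp.ne'
  refine HasDerivAt.congr_deriv (f := smoothSign ε) h2 ?_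
  simp only [smoothAbs, smoothSign, id]
  have hsq : Real.sqrt (t ^ 2 + ε ^ 2) ^ 2 = t ^ 2 + ε ^ 2 := Real.sq_sqrt (by positivity)
  field_simp
  rw [hsq]; ring

lemma abs_smoothSign_le (hε : 0 < ε) (t : ℝ) : |smoothSign ε t| ≤ 1 := by
  rw [smoothSign, abs_div, abs_of_pos (smoothAbs_pos hε t), div_le_one (smoothAbs_pos hε t)]
  exact Real.abs_le_sqrt (by nlinarith)

lemma deriv_smoothSign_nonneg (hε : 0 < ε) (t : ℝ) : 0 ≤ deriv (smoothSign ε) t := by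
  rw [(hasDerivAt_smoothSign hε t).deriv]
  have := smoothAbs_pos hε t
  positivity

lemma abs_deriv_smoothSign_le (hε : 0 < ε) (t : ℝ) : |deriv (smoothSign ε) t| ≤ 1 / ε := by
  rw [abs_of_nonneg (deriv_smoothSign_nonneg hε t), (hasDerivAt_smoothSign hε t).deriv]
  have h1 : ε ≤ Real.sqrt (t ^ 2 + ε ^ 2) := Real.le_sqrt_of_sq_le (by nlinarith)
  calc ε ^ 2 / Real.sqrt (t ^ 2 + ε ^ 2) ^ 3 ≤ ε ^ 2 / ε ^ 3 := by gcongr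
    _ = 1 / ε := by field_simp

lemma le_smoothAbs (ε t : ℝ) : ε ≤ smoothAbs ε t :=
  Real.le_sqrt_of_sq_le (by nlinarith)

lemma smoothAbs_zero (hε : 0 < ε) : smoothAbs ε 0 = ε := by
  simp [smoothAbs, Real.sqrt_sq hε.le]

lemma smoothAbs_le (hε : 0 < ε) (t : ℝ) : smoothAbs ε t ≤ |t| + ε := by
  apply Real.sqrt_le_iff.2
  refine ⟨by positivity, ?_⟩
  nlinarith [abs_nonneg t, sq_abs t]

lemma tendsto_smoothAbs (t : ℝ) :
    Tendsto (fun k : ℕ => smoothAbs (1 / (k + 1 : ℝ)) t) atTop (𝓝 |t|) := by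
  have h := tendsto_one_div_add_atTop_nhds_zero_nat (𝕜 := ℝ)
  have := (((h.pow 2).const_add (t ^ 2)).sqrt)
  simpa [smoothAbs, Real.sqrt_sq_eq_abs] using this

lemma tendsto_smoothSign (t : ℝ) :
    Tendsto (fun k : ℕ => smoothSign (1 / (k + 1 : ℝ)) t) atTop (𝓝 (Real.sign t)) := by
  rcases eq_or_ne t 0 with rfl | ht
  · simp [smoothSign]
  · have h1 := (tendsto_const_nhds (x := t)).div (tendsto_smoothAbs t) (abs_pos.2 ht).ne'
    have h2 : t / |t| = Real.sign t := by
      rcases lt_or_gt_of_ne ht with h | h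
      · rw [Real.sign_of_neg h, abs_of_neg h]; field_simp
      · rw [Real.sign_of_pos h, abs_of_pos h]; field_simp
    rw [h2] at h1
    exact h1

/-- The Heaviside function, with value `1/2` at `0`. -/
def heaviside (t : ℝ) : ℝ := (1 + Real.sign t) / 2

/-- A smooth approximation of the Heaviside function of `t - c`. -/
def smoothStep (ε c t : ℝ) : ℝ := (1 + smoothSign ε (t - c)) / 2

/-- A smooth approximation of `(t - c)⁺`, a primitive of `smoothStep`. -/
def smoothPos (ε c t : ℝ) : ℝ := ((t - c) + smoothAbs ε (t - c)) / 2

lemma contDiff_smoothStep (hε : 0 < ε) (c : ℝ) : ContDiff ℝ ∞ (smoothStep ε c) :=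
  (contDiff_const.add ((contDiff_smoothSign hε).comp (contDiff_id.sub contDiff_const))).div_const 2

lemma contDiff_smoothPos (hε : 0 < ε) (c : ℝ) : ContDiff ℝ ∞ (smoothPos ε c) :=
  ((contDiff_id.sub contDiff_const).add
    ((contDiff_smoothAbs hε).comp (contDiff_id.sub contDiff_const))).div_const 2

lemma deriv_smoothPos (hε : 0 < ε) (c t : ℝ) : deriv (smoothPos ε c) t = smoothStep ε c t := by
  have h1 : HasDerivAt (fun t : ℝ => t - c) 1 t := (hasDerivAt_id t).sub_const c
  have h2 := (hasDerivAt_smoothAbs hε (t - c)).comp t h1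
  have h3 := ((h1.add h2).div_const 2).deriv
  rw [mul_one] at h3
  exact h3

lemma deriv_smoothStep (hε : 0 < ε) (c t : ℝ) :
    deriv (smoothStep ε c) t = deriv (smoothSign ε) (t - c) / 2 := by
  have h1 : HasDerivAt (fun t : ℝ => t - c) 1 t := (hasDerivAt_id t).sub_const c
  have h2 := ((contDiff_smoothSign hε).differentiable (by simp) (t - c)).hasDerivAt.comp t h1
  have h3 := ((h2.const_add 1).div_const 2).deriv
  rw [mul_one] at h3
  exact h3

lemma smoothStep_nonneg (hε : 0 < ε) (c t : ℝ) : 0 ≤ smoothStep ε c t := by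
  have := (abs_le.1 (abs_smoothSign_le hε (t - c))).1
  unfold smoothStep; linarith

lemma abs_smoothStep_le (hε : 0 < ε) (c t : ℝ) : |smoothStep ε c t| ≤ 1 := by
  rw [abs_of_nonneg (smoothStep_nonneg hε c t)]
  have := (abs_le.1 (abs_smoothSign_le hε (t - c))).2
  unfold smoothStep; linarith

/-- At `t = c` every approximant equals `1/2`, since `smoothSign` vanishes at `0`; this dictates the
value of `heaviside` there. -/
lemma tendsto_smoothStep (c t : ℝ) :
    Tendsto (fun k : ℕ => smoothStep (1 / (k + 1 : ℝ)) c t) atTop (𝓝 (heaviside (t - c))) :=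
  ((tendsto_smoothSign (t - c)).const_add 1).div_const 2

lemma tendsto_smoothPos (c t : ℝ) :
    Tendsto (fun k : ℕ => smoothPos (1 / (k + 1 : ℝ)) c t) atTop (𝓝 (max (t - c) 0)) := by
  have h : max (t - c) 0 = ((t - c) + |t - c|) / 2 := by
    rcases le_total 0 (t - c) with h | h
    · rw [max_eq_left h, abs_of_nonneg h]; ring
    · rw [max_eq_right h, abs_of_nonpos h]; ring
  rw [h]
  exact ((tendsto_smoothAbs (t - c)).const_add (t - c)).div_const 2

lemma abs_smoothPos_le (hε : 0 < ε) (hε1 : ε ≤ 1) (c t : ℝ) : |smoothPos ε c t| ≤ |t| + |c| + 1 := by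
  have h1 := smoothAbs_le hε (t - c)
  have h2 := (hε.le.trans (le_smoothAbs ε (t - c)))
  have h3 := abs_sub t c
  rw [smoothPos, abs_div, abs_two, div_le_iff₀ two_pos]
  refine (abs_add_le _ _).trans ?_
  rw [abs_of_nonneg h2]
  linarith [abs_nonneg t, abs_nonneg c]

lemma heaviside_mem (t : ℝ) : heaviside t ∈ Set.Icc (0 : ℝ) 1 := by
  unfold heaviside
  rcases Real.sign_apply_eq t with h | h | h <;> rw [h] <;> constructor <;> norm_num

lemma abs_heaviside_le (t : ℝ) : |heaviside t| ≤ 1 := by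
  have := heaviside_mem t
  rw [abs_of_nonneg this.1]; exact this.2

lemma one_div_succ_pos (k : ℕ) : (0 : ℝ) < 1 / (k + 1 : ℝ) := by positivity

lemma one_div_succ_le_one (k : ℕ) : 1 / (k + 1 : ℝ) ≤ 1 := by
  rw [div_le_one (by positivity)]
  linarith [(Nat.cast_nonneg k : (0 : ℝ) ≤ k)]

lemma measurable_heaviside : Measurable heaviside := by
  refine measurable_of_tendsto_metrizable (f := fun k : ℕ => smoothStep (1 / (k + 1 : ℝ)) 0)
    (fun k => (contDiff_smoothStep (one_div_succ_pos k) 0).continuous.measurable) ?_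
  rw [tendsto_pi_nhds]
  intro t
  simpa using tendsto_smoothStep 0 t

end SmoothSign

/-! ### Truncation in `H¹` and nonnegative test functions. -/

section Truncation

variable {n : ℕ} {Ω : Set (Eucl n)}

lemma memLp_heaviside_smul {u : Eucl n → ℝ} {g : Eucl n → Eucl n}
    (hu : MemLp u 2 (volume.restrict Ω)) (hg : MemLp g 2 (volume.restrict Ω)) (c : ℝ) :
    MemLp (fun x => heaviside (u x - c) • g x) 2 (volume.restrict Ω) :=
  memLp_smul_of_bound
    (measurable_heaviside.comp_aemeasurable
      (hu.1.aemeasurable.sub_const c)).aestronglyMeasurable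
    (Eventually.of_forall fun _ => abs_heaviside_le _) hg

/-- Truncations of `H¹` functions. -/
lemma InH1.posPart [IsFiniteMeasure (volume.restrict Ω)] (hΩ : IsOpen Ω) {u : Eucl n → ℝ}
    {g : Eucl n → Eucl n} (hu : InH1 Ω u g) (c : ℝ) :
    InH1 Ω (fun x => max (u x - c) 0) (fun x => heaviside (u x - c) • g x) := by
  obtain ⟨hu2, hg2, -⟩ := id hu
  have hpos : MemLp (fun x => max (u x - c) 0) 2 (volume.restrict Ω) :=
    (hu2.sub (memLp_const c)).pos_part
  refine ⟨hpos, memLp_heaviside_smul hu2 hg2 c, fun φ hφ i => ?_⟩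
  have hφ2 := hφ.memLp Ω
  have hdφ2 := memLp_coord (hφ.memLp_gradient Ω) i
  have hbound : Integrable (fun x => (|u x| + |c| + 1) * |gradient φ x i|)
      (volume.restrict Ω) := by
    have h1 : MemLp (fun x => |u x| + |c| + 1) 2 (volume.restrict Ω) :=
      (hu2.abs.add (memLp_const |c|)).add (memLp_const 1)
    exact h1.integrable_mul hdφ2.abs
  have hL : Tendsto (fun k : ℕ => ∫ x in Ω, smoothPos (1 / (k + 1 : ℝ)) c (u x) * gradient φ x i)
      atTop (𝓝 (∫ x in Ω, max (u x - c) 0 * gradient φ x i)) := by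
    refine tendsto_integral_of_dominated_convergence _ (fun k => ?_) hbound (fun k => ?_) ?_
    · exact ((contDiff_smoothPos (one_div_succ_pos k) c).continuous.comp_aestronglyMeasurable
        hu2.1).mul hdφ2.1
    · refine Eventually.of_forall fun x => ?_
      rw [norm_mul]
      exact mul_le_mul_of_nonneg_right
        (abs_smoothPos_le (one_div_succ_pos k) (one_div_succ_le_one k) _ _) (norm_nonneg _)
    · exact Eventually.of_forall fun x => (tendsto_smoothPos c (u x)).mul_const _
  have hR : Tendsto (fun k : ℕ => ∫ x in Ω, smoothStep (1 / (k + 1 : ℝ)) c (u x) * g x i * φ x)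
      atTop (𝓝 (∫ x in Ω, heaviside (u x - c) * g x i * φ x)) := by
    refine tendsto_integral_mul_mul (M := 1)
      (fun k => (contDiff_smoothStep (one_div_succ_pos k)
        c).continuous.comp_aestronglyMeasurable hu2.1)
      (fun k x => abs_smoothStep_le (one_div_succ_pos k) _ _)
      (Eventually.of_forall fun x => tendsto_smoothStep c (u x))
      (fun k => memLp_coord hg2 i) (memLp_coord hg2 i) hφ2 (by simp)
  refine tendsto_nhds_unique hL (hR.neg.congr fun k => ?_)
  have hε := one_div_succ_pos k
  have := (hu.comp hΩ ((contDiff_smoothPos hε c).of_le (by simp)) (M := 1) (fun t => by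
    rw [deriv_smoothPos hε]; exact abs_smoothStep_le hε _ _)).2.2 φ hφ i
  rw [this]
  simp only [deriv_smoothPos hε]
  rfl

/-- In essence, `∇v = 0` a.e. on `{v = 0}`. Since `v⁺ = v`, both `heaviside v • h` and `h` are weak
gradients of the same function, and uniqueness identifies them. -/
lemma InH1.sign_smul_ae_eq [IsFiniteMeasure (volume.restrict Ω)] (hΩ : IsOpen Ω) {v : Eucl n → ℝ}
    {h : Eucl n → Eucl n} (hv : InH1 Ω v h) (h0 : ∀ᵐ x ∂(volume.restrict Ω), 0 ≤ v x) :
    ∀ᵐ x ∂(volume.restrict Ω), Real.sign (v x) • h x = h x := by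
  have hae : (fun x => max (v x - 0) 0) =ᵐ[volume.restrict Ω] v := by
    filter_upwards [h0] with x hx
    rw [sub_zero, max_eq_left hx]
  filter_upwards [(hv.posPart hΩ 0).ae_eq hΩ hv hae] with x hx
  simp only [heaviside, sub_zero] at hx
  have : Real.sign (v x) • h x = (2 : ℝ) • (((1 + Real.sign (v x)) / 2) • h x) - h x := by
    module
  rw [this, hx]; module

/-- To test a linear functional on nonnegative `H¹₀` functions it suffices to consider nonnegative
test functions. -/
lemma integral_nonpos_of_testFunction [IsFiniteMeasure (volume.restrict Ω)] (hΩ : IsOpen Ω)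
    {f : Eucl n → Fin n → ℝ} (hf : ∀ i, MemLp (fun x => f x i) 2 (volume.restrict Ω))
    (hneg : ∀ φ, IsTestFunction Ω φ → (∀ x, 0 ≤ φ x) →
      ∑ i, ∫ x in Ω, gradient φ x i * f x i ≤ 0)
    {v : Eucl n → ℝ} {h : Eucl n → Eucl n} (hv : InH10 Ω v h)
    (h0 : ∀ᵐ x ∂(volume.restrict Ω), 0 ≤ v x) :
    ∑ i, ∫ x in Ω, h x i * f x i ≤ 0 := by
  obtain ⟨φ, hφ, -, hφ2, hae⟩ := hv.exists_seq
  -- The approximants `φ k` of `v` need not be nonnegative, so they are replaced by `smoothAbs ε (φ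
  -- k) - ε`, which is nonnegative and smooth; subtracting `ε` keeps the support compact. Its
  -- gradient is `smoothSign ε (φ k) • ∇φ k`, whence the factor that tends to the sign of `v` as `ε
  -- → 0`.
  have step : ∀ ε : ℝ, 0 < ε → ∑ i, ∫ x in Ω, smoothSign ε (v x) * h x i * f x i ≤ 0 := by
    intro ε hε
    have hlim : Tendsto (fun k => ∑ i, ∫ x in Ω,
        smoothSign ε (φ k x) * gradient (φ k) x i * f x i) atTop
        (𝓝 (∑ i, ∫ x in Ω, smoothSign ε (v x) * h x i * f x i)) := by
      refine tendsto_finsetSum _ fun i _ => ?_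
      have hc := (contDiff_smoothSign hε).continuous
      refine tendsto_integral_mul_mul (M := 1)
        (fun k => (hc.comp (hφ k).1.continuous).aestronglyMeasurable)
        (fun k x => abs_smoothSign_le hε _) ?_
        (fun k => memLp_coord ((hφ k).memLp_gradient Ω) i) (memLp_coord hv.1.2.1 i) (hf i) (hφ2 i)
      filter_upwards [hae] with x hx
      exact (hc.tendsto _).comp hx
    refine le_of_tendsto' hlim fun k => ?_
    have hd : ContDiff ℝ ∞ (fun x => smoothAbs ε (φ k x) - ε) :=
      ((contDiff_smoothAbs hε).comp (hφ k).1).sub contDiff_const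
    have hsub : tsupport (fun x => smoothAbs ε (φ k x) - ε) ⊆ tsupport (φ k) := by
      refine closure_mono fun x hx => ?_
      by_contra h
      rw [Function.notMem_support] at h
      apply hx
      simp only [h, smoothAbs_zero hε, sub_self]
    have ht : IsTestFunction Ω (fun x => smoothAbs ε (φ k x) - ε) :=
      ⟨hd, (hφ k).2.1.of_isClosed_subset (isClosed_tsupport _) hsub, hsub.trans (hφ k).2.2⟩
    have := hneg _ ht fun x => sub_nonneg.2 (le_smoothAbs ε _)
    refine le_of_eq_of_le ?_ this
    refine Finset.sum_congr rfl fun i _ => ?_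
    congr 1; ext x
    have hgr : gradient (fun x => smoothAbs ε (φ k x) - ε) x
        = smoothSign ε (φ k x) • gradient (φ k) x := by
      have h1 := gradient_comp (F := fun t => smoothAbs ε t - ε) (f := φ k) (x := x)
        (((hasDerivAt_smoothAbs hε _).sub_const ε).differentiableAt) ((hφ k).differentiable x)
      rw [h1, ((hasDerivAt_smoothAbs hε _).sub_const ε).deriv]
    rw [hgr]; simp
  have hlim : Tendsto (fun k : ℕ => ∑ i, ∫ x in Ω,
      smoothSign (1 / (k + 1 : ℝ)) (v x) * h x i * f x i) atTop
      (𝓝 (∑ i, ∫ x in Ω, Real.sign (v x) * h x i * f x i)) := by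
    refine tendsto_finsetSum _ fun i _ => ?_
    refine tendsto_integral_mul_mul (M := 1)
      (fun k => (contDiff_smoothSign (one_div_succ_pos k)).continuous.comp_aestronglyMeasurable
        hv.1.1.1)
      (fun k x => abs_smoothSign_le (one_div_succ_pos k) _)
      (Eventually.of_forall fun x => tendsto_smoothSign _)
      (fun k => memLp_coord hv.1.2.1 i) (memLp_coord hv.1.2.1 i) (hf i) (by simp)
  have h1 := le_of_tendsto' hlim fun k => step _ (one_div_succ_pos k)
  refine le_of_eq_of_le (Finset.sum_congr rfl fun i _ => integral_congr_ae ?_) h1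
  filter_upwards [hv.1.sign_smul_ae_eq hΩ h0] with x hx
  conv_lhs => rw [← hx]
  simp

end Truncation

/-! ### Truncated subsolutions and the energy inequality. -/

section Elliptic

variable {n : ℕ} {Ω U : Set (Eucl n)} {lam Lam : ℝ} {a : Eucl n → Matrix (Fin n) (Fin n) ℝ}

/-- The vector field `Aᵀ g`, with components `∑ i, a i j * g i`. -/
def flux (a : Eucl n → Matrix (Fin n) (Fin n) ℝ) (g : Eucl n → Eucl n) (x : Eucl n)
    (j : Fin n) : ℝ := ∑ i, a x i j * g x i

lemma sum_mul_flux (a : Eucl n → Matrix (Fin n) (Fin n) ℝ) (g h : Eucl n → Eucl n)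
    (x : Eucl n) : ∑ i, ∑ j, a x i j * g x i * h x j = ∑ j, h x j * flux a g x j := by
  rw [Finset.sum_comm]
  refine Finset.sum_congr rfl fun j _ => ?_
  rw [flux, Finset.mul_sum]
  exact Finset.sum_congr rfl fun i _ => by ring

lemma UniformlyElliptic.mono (ha : UniformlyElliptic Ω lam Lam a) (h : U ⊆ Ω) :
    UniformlyElliptic U lam Lam a :=
  ⟨fun i j => (ha.1 i j).mono_measure (Measure.restrict_mono h le_rfl),
    ae_mono (Measure.restrict_mono h le_rfl) ha.2⟩

lemma UniformlyElliptic.memLp_flux (ha : UniformlyElliptic Ω lam Lam a) {g : Eucl n → Eucl n}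
    (hg : MemLp g 2 (volume.restrict Ω)) (j : Fin n) :
    MemLp (fun x => flux a g x j) 2 (volume.restrict Ω) := by
  unfold flux
  refine memLp_finsetSum _ fun i _ => ?_
  refine memLp_smul_of_bound (C := Lam) (ha.1 i j).aestronglyMeasurable ?_ (memLp_coord hg i)
  filter_upwards [ha.2] with x hx using hx.2 i j

lemma UniformlyElliptic.integrable_mul_flux (ha : UniformlyElliptic Ω lam Lam a)
    {g h : Eucl n → Eucl n} (hg : MemLp g 2 (volume.restrict Ω))
    (hh : MemLp h 2 (volume.restrict Ω)) (j : Fin n) :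
    Integrable (fun x => h x j * flux a g x j) (volume.restrict Ω) :=
  (memLp_coord hh j).integrable_mul (ha.memLp_flux hg j)

lemma UniformlyElliptic.integrable_form (ha : UniformlyElliptic Ω lam Lam a)
    {g h : Eucl n → Eucl n} (hg : MemLp g 2 (volume.restrict Ω))
    (hh : MemLp h 2 (volume.restrict Ω)) :
    Integrable (fun x => ∑ i, ∑ j, a x i j * g x i * h x j) (volume.restrict Ω) := by
  simp_rw [sum_mul_flux]
  exact integrable_finsetSum _ fun j _ => ha.integrable_mul_flux hg hh j

lemma UniformlyElliptic.integral_form (ha : UniformlyElliptic Ω lam Lam a)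
    {g h : Eucl n → Eucl n} (hg : MemLp g 2 (volume.restrict Ω))
    (hh : MemLp h 2 (volume.restrict Ω)) :
    ∫ x in Ω, ∑ i, ∑ j, a x i j * g x i * h x j = ∑ j, ∫ x in Ω, h x j * flux a g x j := by
  simp_rw [sum_mul_flux]
  exact integral_finsetSum _ fun j _ => ha.integrable_mul_flux hg hh j

lemma flux_smul (a : Eucl n → Matrix (Fin n) (Fin n) ℝ) (g : Eucl n → Eucl n) (b : Eucl n → ℝ)
    (x : Eucl n) (j : Fin n) : flux a (fun x => b x • g x) x j = b x * flux a g x j := by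
  simp only [flux, Finset.mul_sum]
  exact Finset.sum_congr rfl fun i _ => by simp; ring

/-- A truncation of a subsolution satisfies the subsolution inequality against nonnegative
test functions. -/
lemma posPart_integral_nonpos [IsFiniteMeasure (volume.restrict Ω)] (hΩ : IsOpen Ω)
    (hlam : 0 ≤ lam) (ha : UniformlyElliptic Ω lam Lam a) {u : Eucl n → ℝ} {g : Eucl n → Eucl n}
    (hu : InH1 Ω u g)
    (hsub : ∀ (v : Eucl n → ℝ) (h : Eucl n → Eucl n), InH10 Ω v h →
      (∀ᵐ x ∂(volume.restrict Ω), 0 ≤ v x) →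
      ∫ x in Ω, ∑ i, ∑ j, a x i j * g x i * h x j ≤ 0) (c : ℝ)
    {φ : Eucl n → ℝ} (hφ : IsTestFunction Ω φ) (hφ0 : ∀ x, 0 ≤ φ x) :
    ∑ j, ∫ x in Ω, gradient φ x j * flux a (fun x => heaviside (u x - c) • g x) x j ≤ 0 := by
  have step : ∀ ε : ℝ, 0 < ε →
      ∑ j, ∫ x in Ω, smoothStep ε c (u x) * gradient φ x j * flux a g x j ≤ 0 := by
    intro ε hε
    have hcont := (contDiff_smoothStep hε c).continuous
    have hcomp := hu.comp hΩ ((contDiff_smoothStep hε c).of_le (by simp)) (M := 1 / ε) (fun t => by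
      rw [deriv_smoothStep hε, abs_div, abs_two]
      exact (half_le_self (abs_nonneg _)).trans (abs_deriv_smoothSign_le hε _))
    -- The test function `φ · smoothStep ε c (u)`. The derivative bound `1 / ε` is only needed for
    -- membership in `H¹₀` and does not enter the limit.
    have htest := hcomp.testFunction_mul hΩ hφ
    have hle := hsub _ _ htest (Eventually.of_forall fun x =>
      mul_nonneg (hφ0 x) (smoothStep_nonneg hε _ _))
    have hm : MemLp (fun x => smoothStep ε c (u x) • gradient φ x) 2 (volume.restrict Ω) :=
      memLp_smul_of_bound (hcont.comp_aestronglyMeasurable hu.1.1)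
        (Eventually.of_forall fun x => abs_smoothStep_le hε _ _) (hφ.memLp_gradient Ω)
    have hform := ha.integral_form hu.2.1 hm
    have e : ∑ j, ∫ x in Ω, smoothStep ε c (u x) * gradient φ x j * flux a g x j
        = ∫ x in Ω, ∑ i, ∑ j, a x i j * g x i * (smoothStep ε c (u x) • gradient φ x) j := by
      rw [hform]; simp
    rw [e]
    refine le_trans ?_ hle
    refine integral_mono_ae (ha.integrable_form hu.2.1 hm)
      (ha.integrable_form hu.2.1 htest.1.2.1) ?_
    filter_upwards [ha.2] with x hx
    have hq : 0 ≤ ∑ i, ∑ j, a x i j * g x i * g x j :=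
      (mul_nonneg hlam (sq_nonneg _)).trans (hx.1 (g x)).1
    have hd : 0 ≤ φ x * deriv (smoothStep ε c) (u x) := by
      refine mul_nonneg (hφ0 x) ?_
      rw [deriv_smoothStep hε]
      exact div_nonneg (deriv_smoothSign_nonneg hε _) two_pos.le
    -- The term in which the derivative falls on the step is `φ · smoothStep' (u) · a(g, g) ≥ 0`, by
    -- monotonicity of the step and ellipticity, and is dropped; the other term converges as `ε →
    -- 0`.
    have hsplit : ∑ i, ∑ j, a x i j * g x i *
        (φ x • (deriv (smoothStep ε c) (u x) • g x) + smoothStep ε c (u x) • gradient φ x) j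
        = φ x * deriv (smoothStep ε c) (u x) * (∑ i, ∑ j, a x i j * g x i * g x j)
          + ∑ i, ∑ j, a x i j * g x i * (smoothStep ε c (u x) • gradient φ x) j := by
      rw [Finset.mul_sum, ← Finset.sum_add_distrib]
      refine Finset.sum_congr rfl fun i _ => ?_
      rw [Finset.mul_sum, ← Finset.sum_add_distrib]
      refine Finset.sum_congr rfl fun j _ => ?_
      simp; ring
    rw [hsplit]
    linarith [mul_nonneg hd hq]
  have hlim : Tendsto (fun k : ℕ => ∑ j, ∫ x in Ω,
      smoothStep (1 / (k + 1 : ℝ)) c (u x) * gradient φ x j * flux a g x j) atTop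
      (𝓝 (∑ j, ∫ x in Ω, heaviside (u x - c) * gradient φ x j * flux a g x j)) := by
    refine tendsto_finsetSum _ fun j _ => ?_
    exact tendsto_integral_mul_mul (M := 1)
      (fun k => (contDiff_smoothStep (one_div_succ_pos k)
        c).continuous.comp_aestronglyMeasurable hu.1.1)
      (fun k x => abs_smoothStep_le (one_div_succ_pos k) _ _)
      (Eventually.of_forall fun x => tendsto_smoothStep c (u x))
      (fun k => memLp_coord (hφ.memLp_gradient Ω) j) (memLp_coord (hφ.memLp_gradient Ω) j)
      (ha.memLp_flux hu.2.1 j) (by simp)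
  have h1 := le_of_tendsto' hlim fun k => step _ (one_div_succ_pos k)
  refine le_of_eq_of_le (Finset.sum_congr rfl fun j _ => ?_) h1
  congr 1; ext x
  rw [flux_smul]; ring

lemma InH1.mono (hΩ : IsOpen Ω) {u : Eucl n → ℝ} {g : Eucl n → Eucl n} (hu : InH1 Ω u g)
    (h : U ⊆ Ω) : InH1 U u g := by
  refine ⟨hu.1.mono_measure (Measure.restrict_mono h le_rfl),
    hu.2.1.mono_measure (Measure.restrict_mono h le_rfl), fun φ hφ i => ?_⟩
  have := hu.2.2 φ (hφ.mono h) i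
  rw [setIntegral_eq_of_subset_of_forall_sdiff_eq_zero hΩ.measurableSet h,
    setIntegral_eq_of_subset_of_forall_sdiff_eq_zero hΩ.measurableSet h] at this
  · exact this
  · intro x hx; rw [hφ.eq_zero hx.2, mul_zero]
  · intro x hx; rw [hφ.gradient_eq_zero hx.2]; simp

/-- Truncations of subsolutions are subsolutions, also in smaller domains. -/
lemma IsSubsolution.posPart [IsFiniteMeasure (volume.restrict Ω)] (hΩ : IsOpen Ω)
    (hU : IsOpen U) (hUΩ : U ⊆ Ω) (hlam : 0 ≤ lam) (ha : UniformlyElliptic Ω lam Lam a)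
    {u : Eucl n → ℝ} (hu : IsSubsolution Ω a u) (c : ℝ) :
    IsNonnegSubsolution U a (fun x => max (u x - c) 0) := by
  obtain ⟨g, hg, hsub⟩ := hu
  have hfin : IsFiniteMeasure (volume.restrict U) :=
    isFiniteMeasure_of_le (volume.restrict Ω) (Measure.restrict_mono hUΩ le_rfl)
  have hw := (hg.posPart hΩ c).mono hΩ hUΩ
  have haU := ha.mono hUΩ
  refine ⟨⟨_, hw, fun v h hv hv0 => ?_⟩, Eventually.of_forall fun x => le_max_right _ _⟩
  rw [haU.integral_form hw.2.1 hv.1.2.1]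
  refine integral_nonpos_of_testFunction hU (fun j => haU.memLp_flux hw.2.1 j)
    (fun φ hφ hφ0 => ?_) hv hv0
  refine le_of_eq_of_le (Finset.sum_congr rfl fun j _ => ?_)
    (posPart_integral_nonpos hΩ hlam ha hg hsub c (hφ.mono hUΩ) hφ0)
  refine (setIntegral_eq_of_subset_of_forall_sdiff_eq_zero hΩ.measurableSet hUΩ
    fun x hx => ?_).symm
  rw [hφ.gradient_eq_zero hx.2]; simp

lemma abs_form_le {A : Matrix (Fin n) (Fin n) ℝ} (hA : ∀ i j, |A i j| ≤ Lam) (p q : Eucl n) :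
    |∑ i, ∑ j, A i j * p i * q j| ≤ n ^ 2 * Lam * ‖p‖ * ‖q‖ := by
  calc |∑ i, ∑ j, A i j * p i * q j| ≤ ∑ i, |∑ j, A i j * p i * q j| :=
        Finset.abs_sum_le_sum_abs _ _
    _ ≤ ∑ i, ∑ j, |A i j * p i * q j| :=
        Finset.sum_le_sum fun i _ => Finset.abs_sum_le_sum_abs _ _
    _ ≤ ∑ _i : Fin n, ∑ _j : Fin n, Lam * ‖p‖ * ‖q‖ := by
        refine Finset.sum_le_sum fun i _ => Finset.sum_le_sum fun j _ => ?_
        have h1 : |p i| ≤ ‖p‖ := PiLp.norm_apply_le p i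
        have h2 : |q j| ≤ ‖q‖ := PiLp.norm_apply_le q j
        have h3 := hA i j
        have h0 : 0 ≤ Lam := (abs_nonneg _).trans h3
        rw [abs_mul, abs_mul]
        gcongr
    _ = _ := by simp; ring

/-- Without symmetry of `A` the two mixed terms do not cancel; they are absorbed by Young's
inequality below. -/
lemma form_sub_add (A : Matrix (Fin n) (Fin n) ℝ) (h p : Eucl n) :
    ∑ i, ∑ j, A i j * (h - p) i * (h + p) j
      = (∑ i, ∑ j, A i j * h i * h j) + (∑ i, ∑ j, A i j * h i * p j)
        - (∑ i, ∑ j, A i j * p i * h j) - ∑ i, ∑ j, A i j * p i * p j := by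
  simp only [← Finset.sum_add_distrib, ← Finset.sum_sub_distrib]
  refine Finset.sum_congr rfl fun i _ => Finset.sum_congr rfl fun j _ => ?_
  simp; ring

/-- The constant in the Caccioppoli inequality. -/
def caccioppoliConst (n : ℕ) (lam Lam : ℝ) : ℝ :=
  2 / lam * (2 * (n ^ 2 * Lam) ^ 2 / lam + Lam)

lemma caccioppoliConst_nonneg (hlam : 0 < lam) (hLam : 0 ≤ Lam) :
    0 ≤ caccioppoliConst n lam Lam := by
  unfold caccioppoliConst; positivity

/-- With `L = n² Λ`, the form is at least `λ‖h‖² - 2L‖h‖‖p‖ - Λ‖p‖²`. Young's inequality spends half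
of the `λ‖h‖²` on the mixed term, which yields `caccioppoliConst`. -/
lemma form_sub_add_ge (hlam : 0 < lam) {A : Matrix (Fin n) (Fin n) ℝ}
    (hA : ∀ i j, |A i j| ≤ Lam)
    (hell : ∀ ξ : Eucl n, lam * ‖ξ‖ ^ 2 ≤ ∑ i, ∑ j, A i j * ξ i * ξ j ∧
      ∑ i, ∑ j, A i j * ξ i * ξ j ≤ Lam * ‖ξ‖ ^ 2) (h p : Eucl n) :
    lam / 2 * (‖h‖ ^ 2 - caccioppoliConst n lam Lam * ‖p‖ ^ 2)
      ≤ ∑ i, ∑ j, A i j * (h - p) i * (h + p) j := by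
  rw [form_sub_add]
  have h1 := (hell h).1
  have h2 := (hell p).2
  have h3 := (abs_le.1 (abs_form_le hA h p)).1
  have h4 := (abs_le.1 (abs_form_le hA p h)).2
  set L := (n : ℝ) ^ 2 * Lam
  have h5 : 2 * L * ‖h‖ * ‖p‖ ≤ lam / 2 * ‖h‖ ^ 2 + 2 * L ^ 2 / lam * ‖p‖ ^ 2 := by
    have h6 : 0 ≤ lam / 2 * (‖h‖ - 2 * L / lam * ‖p‖) ^ 2 := by positivity
    have h7 : lam / 2 * (‖h‖ - 2 * L / lam * ‖p‖) ^ 2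
      = lam / 2 * ‖h‖ ^ 2 + 2 * L ^ 2 / lam * ‖p‖ ^ 2 - 2 * L * ‖h‖ * ‖p‖ := by
      field_simp; ring
    linarith
  have h8 : lam / 2 * (‖h‖ ^ 2 - caccioppoliConst n lam Lam * ‖p‖ ^ 2)
      = lam / 2 * ‖h‖ ^ 2 - 2 * L ^ 2 / lam * ‖p‖ ^ 2 - Lam * ‖p‖ ^ 2 := by
    unfold caccioppoliConst; field_simp; ring
  rw [h8]
  linarith

/-- Caccioppoli's inequality. -/
lemma caccioppoli (hΩ : IsOpen Ω) (hlam : 0 < lam) (ha : UniformlyElliptic Ω lam Lam a)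
    {w : Eucl n → ℝ} {g : Eucl n → Eucl n} (hw : InH1 Ω w g)
    (hsub : ∀ (v : Eucl n → ℝ) (h : Eucl n → Eucl n), InH10 Ω v h →
      (∀ᵐ x ∂(volume.restrict Ω), 0 ≤ v x) →
      ∫ x in Ω, ∑ i, ∑ j, a x i j * g x i * h x j ≤ 0)
    (hw0 : ∀ᵐ x ∂(volume.restrict Ω), 0 ≤ w x) {η : Eucl n → ℝ} (hη : IsTestFunction Ω η) :
    ∫ x in Ω, ‖η x • g x + w x • gradient η x‖ ^ 2
      ≤ caccioppoliConst n lam Lam * ∫ x in Ω, ‖w x • gradient η x‖ ^ 2 := by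
  have h1 := hw.testFunction_mul hΩ hη
  -- The test function is `η² w`, built as `η · (η w)`.
  have h2 := h1.1.testFunction_mul hΩ hη
  have hp : MemLp (fun x => w x • gradient η x) 2 (volume.restrict Ω) := by
    obtain ⟨D, hD⟩ := exists_bound_of_hasCompactSupport hη.continuous_gradient
      (hasCompactSupport_gradient hη.2.1)
    refine hw.1.of_le_mul (c := D)
      (hw.1.1.smul hη.continuous_gradient.aestronglyMeasurable) (Eventually.of_forall fun x => ?_)
    rw [norm_smul, mul_comm]
    exact mul_le_mul_of_nonneg_right (hD x) (norm_nonneg _)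
  have hle := hsub _ _ h2 (by
    filter_upwards [hw0] with x hx
    rw [← mul_assoc]
    exact mul_nonneg (mul_self_nonneg _) hx)
  have i1 := h1.1.2.1.integrable_norm_pow (by norm_num)
  have i2 := hp.integrable_norm_pow (by norm_num)
  have key : ∫ x in Ω, lam / 2 * (‖η x • g x + w x • gradient η x‖ ^ 2
      - caccioppoliConst n lam Lam * ‖w x • gradient η x‖ ^ 2) ≤ 0 := by
    refine le_trans ?_ hle
    refine integral_mono_ae ((i1.sub (i2.const_mul _)).const_mul _)
      (ha.integrable_form hw.2.1 h2.1.2.1) ?_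
    filter_upwards [ha.2] with x hx
    -- Let `h = ∇(η w)` and `p = w ∇η`. Then `η g = h - p` and `∇(η² w) = η (h + p)`, so `a(g, ∇(η²
    -- w)) = a(h - p, h + p)`.
    refine (form_sub_add_ge hlam hx.2 hx.1 _ _).trans (le_of_eq ?_)
    refine Finset.sum_congr rfl fun i _ => Finset.sum_congr rfl fun j _ => ?_
    simp; ring
  rw [integral_const_mul, integral_sub i1 (i2.const_mul _), integral_const_mul] at key
  have := nonpos_of_mul_nonpos_right key (half_pos hlam)
  linarith

end Elliptic

/-! ### Non-concentration of `H¹₀` functions on small sets. -/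

section SmallSets

variable {n : ℕ} {Ω : Set (Eucl n)}

/-- Integrate `f(x)² ≤ 2 (f(x+t) - f(x))² + 2 f(x+t)²` over `x ∈ E` and `t ∈ B_δ`. The difference is
controlled by the gradient; in the last term, integrating in `t` first leaves at most `‖f‖²` for
each `x`, hence the factor `|E|`. -/
lemma measure_ball_mul_lintegral_le {f : Eucl n → ℝ} (hf : ContDiff ℝ 1 f) (E : Set (Eucl n))
    (δ : ℝ) :
    volume (ballZero n δ) * ∫⁻ x in E, ‖f x‖ₑ ^ 2
      ≤ volume (ballZero n δ) * (2 * ENNReal.ofReal δ ^ 2 * ∫⁻ x, ‖gradient f x‖ₑ ^ 2)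
        + 2 * volume E * ∫⁻ x, ‖f x‖ₑ ^ 2 := by
  have hfc := hf.continuous
  have hpt : ∀ x t : Eucl n, ‖f x‖ₑ ^ 2 ≤ 2 * ‖f (x + t) - f x‖ₑ ^ 2 + 2 * ‖f (x + t)‖ₑ ^ 2 := by
    intro x t
    have h1 : ‖f x‖ₑ ≤ ‖f (x + t) - f x‖ₑ + ‖f (x + t)‖ₑ := by
      have e : f x = -(f (x + t) - f x) + f (x + t) := by ring
      calc ‖f x‖ₑ = ‖-(f (x + t) - f x) + f (x + t)‖ₑ := by rw [← e]
        _ ≤ _ := by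
          refine (enorm_add_le _ _).trans_eq ?_
          rw [enorm_neg]
    calc ‖f x‖ₑ ^ 2 ≤ (‖f (x + t) - f x‖ₑ + ‖f (x + t)‖ₑ) ^ 2 := by gcongr
      _ ≤ 2 ^ (2 - 1) * (‖f (x + t) - f x‖ₑ ^ 2 + ‖f (x + t)‖ₑ ^ 2) := by
          have := ENNReal.rpow_add_le_mul_rpow_add_rpow ‖f (x + t) - f x‖ₑ ‖f (x + t)‖ₑ
            (p := 2) (by norm_num)
          norm_num at this ⊢
          exact this
      _ = _ := by norm_num; ring
  have m1 : ∀ t, Measurable fun x => ‖f (x + t) - f x‖ₑ ^ 2 := fun t =>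
    (Continuous.enorm (by fun_prop)).measurable.pow_const _
  have m2 : Measurable fun p : Eucl n × Eucl n => ‖f (p.2 + p.1)‖ₑ ^ 2 :=
    (Continuous.enorm (by fun_prop)).measurable.pow_const _
  calc volume (ballZero n δ) * ∫⁻ x in E, ‖f x‖ₑ ^ 2
      = ∫⁻ _ in ballZero n δ, ∫⁻ x in E, ‖f x‖ₑ ^ 2 := by
        rw [setLIntegral_const, mul_comm]
    _ ≤ ∫⁻ t in ballZero n δ, (2 * ENNReal.ofReal δ ^ 2 * ∫⁻ x, ‖gradient f x‖ₑ ^ 2)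
          + 2 * ∫⁻ x in E, ‖f (x + t)‖ₑ ^ 2 := by
        refine setLIntegral_mono' measurableSet_ball fun t ht => ?_
        calc ∫⁻ x in E, ‖f x‖ₑ ^ 2
            ≤ ∫⁻ x in E, (2 * ‖f (x + t) - f x‖ₑ ^ 2 + 2 * ‖f (x + t)‖ₑ ^ 2) :=
              lintegral_mono fun x => hpt x t
          _ = 2 * (∫⁻ x in E, ‖f (x + t) - f x‖ₑ ^ 2) + 2 * ∫⁻ x in E, ‖f (x + t)‖ₑ ^ 2 := by
              rw [lintegral_add_left ((m1 t).const_mul _), lintegral_const_mul _ (m1 t),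
                lintegral_const_mul' _ _ (by simp)]
          _ ≤ _ := by
              rw [mul_assoc 2]
              refine add_le_add (mul_le_mul_right ?_ 2) le_rfl
              refine (setLIntegral_le_lintegral _ _).trans
                ((lintegral_translate_sub_le hf t).trans ?_)
              gcongr
              rw [← ofReal_norm]
              exact ENNReal.ofReal_le_ofReal (mem_ball_zero_iff.1 ht).le
    _ = volume (ballZero n δ) * (2 * ENNReal.ofReal δ ^ 2 * ∫⁻ x, ‖gradient f x‖ₑ ^ 2)
          + 2 * ∫⁻ t in ballZero n δ, ∫⁻ x in E, ‖f (x + t)‖ₑ ^ 2 := by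
        rw [lintegral_add_left measurable_const, setLIntegral_const, mul_comm,
          lintegral_const_mul' _ _ (by simp)]
    _ ≤ _ := by
        rw [mul_assoc 2 (volume E)]
        refine add_le_add le_rfl (mul_le_mul_right ?_ 2)
        rw [lintegral_lintegral_swap m2.aemeasurable]
        calc ∫⁻ x in E, ∫⁻ t in ballZero n δ, ‖f (x + t)‖ₑ ^ 2
            ≤ ∫⁻ _ in E, ∫⁻ y, ‖f y‖ₑ ^ 2 := by
              refine lintegral_mono fun x => (setLIntegral_le_lintegral _ _).trans_eq ?_
              exact lintegral_add_left_eq_self (fun y => ‖f y‖ₑ ^ 2) x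
          _ = _ := by rw [setLIntegral_const, mul_comm]

lemma tendsto_eLpNorm_of_sub {α E : Type*} [MeasurableSpace α] [NormedAddCommGroup E]
    {μ : Measure α} {v : α → E} {φ : ℕ → α → E} (hv : MemLp v 2 μ) (hφ : ∀ k, MemLp (φ k) 2 μ)
    (h : Tendsto (fun k => eLpNorm (fun x => v x - φ k x) 2 μ) atTop (𝓝 0)) :
    Tendsto (fun k => eLpNorm (φ k) 2 μ) atTop (𝓝 (eLpNorm v 2 μ)) := by
  have h1 : Tendsto (fun k => eLpNorm v 2 μ - eLpNorm (fun x => v x - φ k x) 2 μ) atTop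
      (𝓝 (eLpNorm v 2 μ)) := by
    simpa using ENNReal.Tendsto.sub (tendsto_const_nhds (x := eLpNorm v 2 μ)) h
      (Or.inl hv.2.ne)
  have h2 : Tendsto (fun k => eLpNorm v 2 μ + eLpNorm (fun x => v x - φ k x) 2 μ) atTop
      (𝓝 (eLpNorm v 2 μ)) := by
    simpa using (tendsto_const_nhds (x := eLpNorm v 2 μ)).add h
  refine tendsto_of_tendsto_of_tendsto_of_le_of_le h1 h2 (fun k => ?_) fun k => ?_
  · refine tsub_le_iff_left.2 ?_
    have := eLpNorm_add_le (hv.sub (hφ k)).1 (hφ k).1 (p := 2) (by norm_num)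
    rwa [sub_add_cancel] at this
  · have := eLpNorm_sub_le hv.1 (hv.sub (hφ k)).1 (p := 2) (by norm_num)
    rwa [sub_sub_cancel] at this

lemma eLpNorm_restrict_of_eq_zero {E : Type*} [NormedAddCommGroup E] (hΩ : IsOpen Ω)
    {f : Eucl n → E} (h : ∀ x ∉ Ω, f x = 0) :
    eLpNorm f 2 (volume.restrict Ω) = eLpNorm f 2 volume := by
  have : Ω.indicator f = f := Set.indicator_eq_self.2 fun x hx => by
    by_contra h'; exact hx (h x h')
  rw [← eLpNorm_indicator_eq_eLpNorm_restrict hΩ.measurableSet, this]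

/-- Functions in `H¹₀` cannot concentrate on small sets. -/
lemma InH10.measure_ball_mul_eLpNorm_le (hΩ : IsOpen Ω) {v : Eucl n → ℝ} {h : Eucl n → Eucl n}
    (hv : InH10 Ω v h) {E : Set (Eucl n)} (hE : E ⊆ Ω) (hE' : volume E ≠ ⊤) (δ : ℝ) :
    volume (ballZero n δ) * eLpNorm v 2 (volume.restrict E) ^ 2
      ≤ volume (ballZero n δ) * (2 * ENNReal.ofReal δ ^ 2 * eLpNorm h 2 (volume.restrict Ω) ^ 2)
        + 2 * volume E * eLpNorm v 2 (volume.restrict Ω) ^ 2 := by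
  obtain ⟨⟨hv2, hh2, -⟩, φ, hφ, h1, h2⟩ := hv
  have hmono : volume.restrict E ≤ volume.restrict Ω := Measure.restrict_mono hE le_rfl
  have t1 := tendsto_eLpNorm_of_sub hv2 (fun k => (hφ k).memLp Ω) h1
  have t2 := tendsto_eLpNorm_of_sub hh2 (fun k => (hφ k).memLp_gradient Ω) h2
  have t3 := tendsto_eLpNorm_of_sub (hv2.mono_measure hmono) (fun k => (hφ k).memLp E)
    (tendsto_of_tendsto_of_tendsto_of_le_of_le tendsto_const_nhds h1
      (fun k => zero_le) fun k => eLpNorm_mono_measure _ hmono)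
  have hB : volume (ballZero n δ) ≠ ⊤ := measure_ball_lt_top.ne
  have p2 : ∀ {s : ℕ → ℝ≥0∞} {b : ℝ≥0∞}, Tendsto s atTop (𝓝 b) →
      Tendsto (fun k => s k ^ 2) atTop (𝓝 (b ^ 2)) := fun hs =>
    ((ENNReal.continuous_pow 2).tendsto _).comp hs
  have L := ENNReal.Tendsto.const_mul (p2 t3) (Or.inr hB)
  have hδ' : 2 * ENNReal.ofReal δ ^ 2 ≠ ⊤ := by finiteness
  have hE2 : 2 * volume E ≠ ⊤ := by finiteness
  have R1 := ENNReal.Tendsto.const_mul (ENNReal.Tendsto.const_mul (p2 t2) (Or.inr hδ'))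
    (Or.inr hB)
  have R2 := ENNReal.Tendsto.const_mul (p2 t1) (Or.inr hE2)
  refine le_of_tendsto_of_tendsto' L (R1.add R2) fun k => ?_
  rw [eLpNorm_restrict_of_eq_zero hΩ fun x hx => (hφ k).eq_zero hx,
    eLpNorm_restrict_of_eq_zero hΩ fun x hx => (hφ k).gradient_eq_zero hx,
    eLpNorm_two_sq, eLpNorm_two_sq, eLpNorm_two_sq]
  exact measure_ball_mul_lintegral_le (hφ k).contDiff_one E δ

end SmallSets

/-! ### Existence of level constants. -/

section Level

variable {n : ℕ} {lam Lam : ℝ} {a : Eucl n → Matrix (Fin n) (Fin n) ℝ}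

instance isFiniteMeasure_restrict_ballZero (r : ℝ) :
    IsFiniteMeasure (volume.restrict (ballZero n r)) :=
  ⟨by simpa using measure_ball_lt_top⟩

/-- Cutoff functions for the pair of balls `B_{r/2} ⊆ B_r` with gradient of order `1/r`. -/
lemma exists_cutoff_ball (n : ℕ) : ∃ N : ℝ, 0 ≤ N ∧ ∀ r : ℝ, 0 < r → ∃ η : Eucl n → ℝ,
    IsTestFunction (ballZero n r) η ∧ (∀ x, |η x| ≤ 1) ∧ (∀ x ∈ ballZero n (r / 2), η x = 1) ∧
      ∀ x, ‖gradient η x‖ ≤ N / r := by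
  obtain ⟨ψ, hψ, hψ1, hψ2⟩ := IsTestFunction.exists_cutoff (Ω := ballZero n 1)
    Metric.isOpen_ball (isCompact_closedBall (0 : Eucl n) (1 / 2))
    (Metric.closedBall_subset_ball (by norm_num))
  obtain ⟨N, hN⟩ := exists_bound_of_hasCompactSupport hψ.continuous_gradient
    (hasCompactSupport_gradient hψ.2.1)
  refine ⟨N, (norm_nonneg _).trans (hN 0), fun r hr => ?_⟩
  have hr' : r⁻¹ ≠ 0 := inv_ne_zero hr.ne'
  -- Rescaling one fixed cutoff of the unit ball makes `N` independent of `r`.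
  refine ⟨fun x => ψ (r⁻¹ • x), ⟨hψ.1.comp (contDiff_const_smul _), ?_, ?_⟩, fun x => ?_,
    fun x hx => ?_, fun x => ?_⟩
  · exact hψ.2.1.comp_homeomorph (Homeomorph.smulOfNeZero r⁻¹ hr')
  · intro x hx
    have h1 : r⁻¹ • x ∈ tsupport ψ :=
      tsupport_comp_subset_preimage ψ (continuous_const_smul r⁻¹) hx
    have h2 := mem_ball_zero_iff.1 (hψ.2.2 h1)
    rw [norm_smul, norm_inv, Real.norm_of_nonneg hr.le, inv_mul_lt_iff₀ hr, mul_one] at h2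
    exact mem_ball_zero_iff.2 h2
  · rw [abs_of_nonneg (hψ1 _).1]; exact (hψ1 _).2
  · refine (hψ2 _ ?_).1
    rw [mem_closedBall_zero_iff, norm_smul, norm_inv, Real.norm_of_nonneg hr.le,
      inv_mul_le_iff₀ hr]
    linarith [mem_ball_zero_iff.1 hx]
  · have h1 : gradient (fun x => ψ (r⁻¹ • x)) x = r⁻¹ • gradient ψ (r⁻¹ • x) := by
      ext i
      rw [PiLp.smul_apply, gradient_apply, gradient_apply]
      have h2 : HasFDerivAt (fun x : Eucl n => r⁻¹ • x)
          (r⁻¹ • ContinuousLinearMap.id ℝ (Eucl n)) x := (hasFDerivAt_id x).const_smul r⁻¹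
      have h3 := (hψ.differentiable (r⁻¹ • x)).hasFDerivAt.comp x h2
      change fderiv ℝ (ψ ∘ fun x => r⁻¹ • x) x _ = _
      rw [h3.fderiv]; simp
    rw [h1, norm_smul, norm_inv, Real.norm_of_nonneg hr.le, div_eq_inv_mul]
    exact mul_le_mul_of_nonneg_left (hN _) (by positivity)

lemma toReal_eLpNorm_two_sq {α E : Type*} [MeasurableSpace α] [NormedAddCommGroup E]
    {μ : Measure α} {f : α → E} (hf : MemLp f 2 μ) :
    (eLpNorm f 2 μ ^ 2).toReal = ∫ x, ‖f x‖ ^ 2 ∂μ := by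
  rw [eLpNorm_two_sq, integral_eq_lintegral_of_nonneg_ae (Eventually.of_forall fun x => by
    positivity) (hf.1.norm.aemeasurable.pow_const 2).aestronglyMeasurable]
  congr 1
  refine lintegral_congr fun x => ?_
  rw [ENNReal.ofReal_pow (norm_nonneg _), ofReal_norm]

lemma InH10.measureReal_ball_mul_integral_le {Ω : Set (Eucl n)} (hΩ : IsOpen Ω)
    {v : Eucl n → ℝ} {h : Eucl n → Eucl n}
    (hv : InH10 Ω v h) {E : Set (Eucl n)} (hE : E ⊆ Ω) (hE' : volume E ≠ ⊤) {δ : ℝ} (hδ : 0 ≤ δ) :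
    volume.real (ballZero n δ) * ∫ x in E, v x ^ 2
      ≤ volume.real (ballZero n δ) * (2 * δ ^ 2 * ∫ x in Ω, ‖h x‖ ^ 2)
        + 2 * volume.real E * ∫ x in Ω, v x ^ 2 := by
  have key := hv.measure_ball_mul_eLpNorm_le hΩ hE hE' δ
  have hB : volume (ballZero n δ) ≠ ⊤ := measure_ball_lt_top.ne
  have h1 := hv.1.1.2.ne
  have h2 := hv.1.2.1.2.ne
  have f1 : volume (ballZero n δ) * (2 * ENNReal.ofReal δ ^ 2 * eLpNorm h 2 (volume.restrict Ω) ^ 2)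
    ≠ ⊤ := by finiteness
  have f2 : 2 * volume E * eLpNorm v 2 (volume.restrict Ω) ^ 2 ≠ ⊤ := by finiteness
  have hvE : MemLp v 2 (volume.restrict E) :=
    hv.1.1.mono_measure (Measure.restrict_mono hE le_rfl)
  have := ENNReal.toReal_mono (ENNReal.add_ne_top.2 ⟨f1, f2⟩) key
  rw [ENNReal.toReal_add f1 f2] at this
  simp only [ENNReal.toReal_mul, toReal_eLpNorm_two_sq hvE, toReal_eLpNorm_two_sq hv.1.1,
    toReal_eLpNorm_two_sq hv.1.2.1, ENNReal.toReal_pow, ENNReal.toReal_ofReal hδ,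
    ENNReal.toReal_ofNat, Real.norm_eq_abs, sq_abs] at this
  exact this

lemma measureReal_ballZero {r : ℝ} (s : ℝ) (hr : 0 < r) :
    volume.real (ballZero n (r * s)) = r ^ n * volume.real (ballZero n s) := by
  have := congrArg ENNReal.toReal
    (Measure.addHaar_ball_mul_of_pos (volume : Measure (Eucl n)) 0 hr s)
  rw [ENNReal.toReal_mul, ENNReal.toReal_ofReal (by positivity)] at this
  simpa [Measure.real] using this

lemma measureReal_ballZero_pos {r : ℝ} (hr : 0 < r) : 0 < volume.real (ballZero n r) :=
  ENNReal.toReal_pos (Metric.measure_ball_pos volume 0 hr).ne' measure_ball_lt_top.ne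

lemma l2avg_nonneg (r : ℝ) (u : Eucl n → ℝ) : 0 ≤ l2avg r u := Real.sqrt_nonneg _

lemma l2avg_sq (r : ℝ) (u : Eucl n → ℝ) :
    l2avg r u ^ 2 = (volume.real (ballZero n r))⁻¹ * ∫ x in ballZero n r, u x ^ 2 := by
  rw [l2avg, setAverage_eq, smul_eq_mul, Real.sq_sqrt]
  exact mul_nonneg (inv_nonneg.2 measureReal_nonneg) (integral_nonneg fun x => sq_nonneg _)

lemma integral_sq_mono {α : Type*} [MeasurableSpace α] {μ : Measure α} {f g : α → ℝ}
    (hg : MemLp g 2 μ) (h : ∀ᵐ x ∂μ, |f x| ≤ |g x|) : ∫ x, f x ^ 2 ∂μ ≤ ∫ x, g x ^ 2 ∂μ :=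
  integral_mono_of_nonneg (Eventually.of_forall fun _ => sq_nonneg _) hg.integrable_sq
    (by filter_upwards [h] with x hx using sq_le_sq.2 hx)

/-- The energy estimate behind the existence of level constants. -/
lemma integral_posPart_sq_le {N : ℝ} (hlam : 0 < lam) (hLam : 0 ≤ Lam) {r : ℝ} (hr : 0 < r)
    (ha : UniformlyElliptic (ballZero n r) lam Lam a) {u : Eucl n → ℝ}
    (hu : IsNonnegSubsolution (ballZero n r) a u) {η : Eucl n → ℝ}
    (hη : IsTestFunction (ballZero n r) η) (hη1 : ∀ x, |η x| ≤ 1)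
    (hη2 : ∀ x ∈ ballZero n (r / 2), η x = 1) (hηN : ∀ x, ‖gradient η x‖ ≤ N / r)
    {t : ℝ} (ht : 0 ≤ t) {δ : ℝ} (hδ : 0 ≤ δ) :
    volume.real (ballZero n δ) * ∫ x in ballZero n (r / 2), max (u x - t) 0 ^ 2
      ≤ (volume.real (ballZero n δ) * (2 * δ ^ 2 * (caccioppoliConst n lam Lam * (N / r) ^ 2))
        + 2 * volume.real {x | x ∈ ballZero n r ∧ t < u x}) * ∫ x in ballZero n r, u x ^ 2 := by
  set Ω := ballZero n r with hΩdef
  have hΩ : IsOpen Ω := Metric.isOpen_ball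
  have hu2 : MemLp u 2 (volume.restrict Ω) := hu.1.choose_spec.1.1
  obtain ⟨⟨g, hw, hsub⟩, hw0⟩ := hu.1.posPart hΩ hΩ subset_rfl hlam.le ha t
  set w : Eucl n → ℝ := fun x => max (u x - t) 0 with hwdef
  have hwu : ∀ᵐ x ∂(volume.restrict Ω), |w x| ≤ |u x| := by
    filter_upwards [hu.2] with x hx
    rw [abs_of_nonneg (le_max_right _ _), abs_of_nonneg hx]
    exact max_le (by linarith) hx
  have hcacc := caccioppoli hΩ hlam ha hw hsub hw0 hη
  have hH10 := hw.testFunction_mul hΩ hη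
  set h := fun x => η x • g x + w x • gradient η x
  have I0 : 0 ≤ ∫ x in Ω, u x ^ 2 := integral_nonneg fun x => sq_nonneg _
  have hh : ∫ x in Ω, ‖h x‖ ^ 2 ≤ caccioppoliConst n lam Lam * (N / r) ^ 2 * ∫ x in Ω, u x ^ 2 := by
    refine hcacc.trans ?_
    rw [mul_assoc]
    refine mul_le_mul_of_nonneg_left ?_ (caccioppoliConst_nonneg hlam hLam)
    rw [← integral_const_mul]
    refine integral_mono_of_nonneg (Eventually.of_forall fun _ => sq_nonneg _)
      (hu2.integrable_sq.const_mul _) ?_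
    filter_upwards [hwu] with x hx
    rw [norm_smul, mul_pow, mul_comm, Real.norm_eq_abs, sq_abs]
    have h1 : ‖gradient η x‖ ^ 2 ≤ (N / r) ^ 2 := pow_le_pow_left₀ (norm_nonneg _) (hηN x) 2
    have h2 : w x ^ 2 ≤ u x ^ 2 := sq_le_sq.2 hx
    exact mul_le_mul h1 h2 (sq_nonneg _) (sq_nonneg _)
  have hv : ∫ x in Ω, (η x * w x) ^ 2 ≤ ∫ x in Ω, u x ^ 2 := by
    refine integral_sq_mono hu2 ?_
    filter_upwards [hwu] with x hx
    rw [abs_mul]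
    exact (mul_le_of_le_one_left (abs_nonneg _) (hη1 x)).trans hx
  set E₀ := {x | x ∈ Ω ∧ t < u x}
  have hE₀ : E₀ ⊆ Ω := fun x hx => hx.1
  -- As `u` is only a.e. measurable, `{u > t}` need not be measurable; a measurable hull within `Ω`
  -- has no larger measure.
  set E := toMeasurable volume E₀ ∩ Ω
  have hE : MeasurableSet E := (measurableSet_toMeasurable _ _).inter hΩ.measurableSet
  have hEΩ : E ⊆ Ω := Set.inter_subset_right
  have hΩtop : volume Ω ≠ ⊤ := measure_ball_lt_top.ne
  have hEtop : volume E ≠ ⊤ := measure_ne_top_of_subset hEΩ hΩtop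
  have hEreal : volume.real E ≤ volume.real E₀ :=
    ENNReal.toReal_mono (measure_ne_top_of_subset hE₀ hΩtop)
      ((measure_mono Set.inter_subset_left).trans_eq (measure_toMeasurable E₀))
  have key := hH10.measureReal_ball_mul_integral_le hΩ hEΩ hEtop hδ
  have hhalf : ballZero n (r / 2) ⊆ Ω := Metric.ball_subset_ball (by linarith)
  -- On the half ball `η = 1`, and `w` vanishes where `u ≤ t`.
  have hloc : ∫ x in ballZero n (r / 2), w x ^ 2 ≤ ∫ x in E, (η x * w x) ^ 2 := by
    have hint : IntegrableOn (fun x => (η x * w x) ^ 2) E :=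
      hH10.1.1.integrable_sq.mono_measure (Measure.restrict_mono hEΩ le_rfl)
    rw [← integral_indicator measurableSet_ball, ← integral_indicator hE]
    refine integral_mono_of_nonneg
      (Eventually.of_forall fun x => Set.indicator_nonneg (fun _ _ => sq_nonneg _) _)
      (hint.integrable_indicator hE) (Eventually.of_forall fun x => ?_)
    by_cases hx : x ∈ ballZero n (r / 2)
    · by_cases hxt : t < u x
      · have hxE : x ∈ E := ⟨subset_toMeasurable _ _ ⟨hhalf hx, hxt⟩, hhalf hx⟩
        simp only [Set.indicator_of_mem hx, Set.indicator_of_mem hxE, hη2 x hx, one_mul, le_refl]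
      · have : w x = 0 := max_eq_right (by linarith)
        simp only [Set.indicator_of_mem hx, this]
        simpa using Set.indicator_nonneg (fun _ _ => sq_nonneg _) _
    · simp only [Set.indicator_of_notMem hx]
      exact Set.indicator_nonneg (fun _ _ => sq_nonneg _) _
  have hb : 0 ≤ volume.real (ballZero n δ) := measureReal_nonneg
  calc _ ≤ volume.real (ballZero n δ) * ∫ x in E, (η x * w x) ^ 2 :=
        mul_le_mul_of_nonneg_left hloc hb
    _ ≤ _ := key
    _ ≤ volume.real (ballZero n δ) * (2 * δ ^ 2 * (caccioppoliConst n lam Lam * (N / r) ^ 2 *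
          ∫ x in Ω, u x ^ 2)) + 2 * volume.real E₀ * ∫ x in Ω, u x ^ 2 := by gcongr
    _ = _ := by ring

/-- Chebyshev's inequality for `u²`. -/
lemma sq_mul_measureReal_lt_le {Ω : Set (Eucl n)} (hΩ : MeasurableSet Ω)
    [IsFiniteMeasure (volume.restrict Ω)] {u : Eucl n → ℝ}
    (hu : MemLp u 2 (volume.restrict Ω)) {t : ℝ} (ht : 0 ≤ t) :
    t ^ 2 * volume.real {x | x ∈ Ω ∧ t < u x} ≤ ∫ x in Ω, u x ^ 2 := by
  have h := mul_meas_ge_le_integral_of_nonneg (μ := volume.restrict Ω) (f := fun x => u x ^ 2)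
    (Eventually.of_forall fun _ => sq_nonneg _) hu.integrable_sq (t ^ 2)
  refine le_trans (mul_le_mul_of_nonneg_left ?_ (sq_nonneg t)) h
  have hle : volume {x | x ∈ Ω ∧ t < u x} ≤ volume.restrict Ω {x | t ^ 2 ≤ u x ^ 2} := by
    rw [Measure.restrict_apply' hΩ]
    exact measure_mono fun x hx => ⟨pow_le_pow_left₀ ht hx.2.le 2, hx.1⟩
  exact ENNReal.toReal_mono (measure_ne_top _ _) hle

theorem exists_isLevelConstant (n : ℕ) (hlam : 0 < lam) (hLam : 0 ≤ Lam) :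
    ∃ A : ℝ, IsLevelConstant n lam Lam A := by
  obtain ⟨N, hN, hcut⟩ := exists_cutoff_ball n
  set C := caccioppoliConst n lam Lam * N ^ 2 with hC
  have hC0 : 0 ≤ C := mul_nonneg (caccioppoliConst_nonneg hlam hLam) (sq_nonneg _)
  -- Chosen so that the gradient term, multiplied by `|B_r| / |B_{r/2}| = 2ⁿ`, contributes at most
  -- `2ⁿ · 2θ²C ≤ 1/8`.
  set θ := Real.sqrt (1 / (2 ^ n * 16 * (C + 1))) with hθ
  have hθ0 : 0 < θ := Real.sqrt_pos.2 (by positivity)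
  have hθ2 : θ ^ 2 = 1 / (2 ^ n * 16 * (C + 1)) := Real.sq_sqrt (by positivity)
  -- Chosen so that the measure term also contributes at most `1/8`. The sum `1/4` is the square of
  -- the required factor `1/2`.
  set D := 2 ^ n * 16 / θ ^ n with hD
  have hD0 : 0 < D := by positivity
  refine ⟨1 + D, by linarith, fun r hr a ha u hu => ?_⟩
  obtain ⟨η, hη, hη1, hη2, hηN⟩ := hcut r hr
  set m := l2avg r u with hm
  have hm0 : 0 ≤ m := l2avg_nonneg r u
  have ht : 0 ≤ (1 + D) * m := by positivity
  set t := (1 + D) * m with htdef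
  have hu2 : MemLp u 2 (volume.restrict (ballZero n r)) := hu.1.choose_spec.1.1
  set b := volume.real (ballZero n r) with hb
  have hb0 : 0 < b := measureReal_ballZero_pos hr
  set I := ∫ x in ballZero n r, u x ^ 2 with hI
  have hI0 : 0 ≤ I := integral_nonneg fun x => sq_nonneg _
  have hmI : m ^ 2 = b⁻¹ * I := l2avg_sq r u
  have hbhalf : volume.real (ballZero n (r / 2)) = (1 / 2) ^ n * b := by
    rw [← measureReal_ballZero r (by norm_num : (0 : ℝ) < 1 / 2)]
    congr 2; ring
  have hbδ : volume.real (ballZero n (θ * r)) = θ ^ n * b := measureReal_ballZero r hθ0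
  have hest := integral_posPart_sq_le hlam hLam hr ha hu hη hη1 hη2 hηN ht
    (δ := θ * r) (by positivity)
  have hcheb := sq_mul_measureReal_lt_le (Ω := ballZero n r) measurableSet_ball hu2 ht
  set e := volume.real {x | x ∈ ballZero n r ∧ t < u x} with he
  have he0 : 0 ≤ e := measureReal_nonneg
  set Y := ∫ x in ballZero n (r / 2), max (u x - t) 0 ^ 2 with hY
  -- Chebyshev gives `(1 + D)² e ≤ b` when `I > 0`, more than the `D e ≤ b` used here. Keeping the
  -- factor `I` covers the degenerate case `I = 0`, where `t = 0` and Chebyshev says nothing about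
  -- `e`.
  have heI : e * I * D ≤ b * I := by
    rcases hI0.eq_or_lt with h0 | hpos
    · simp [← h0]
    · have h1 : t ^ 2 * e = (1 + D) ^ 2 * e * b⁻¹ * I := by
        rw [htdef, mul_pow, hmI]; ring
      have h2 : (1 + D) ^ 2 * e * b⁻¹ ≤ 1 := by
        rw [h1] at hcheb
        exact le_of_mul_le_mul_right (by rw [one_mul]; exact hcheb) hpos
      have h3 : (1 + D) ^ 2 * e ≤ b := by
        rwa [← div_eq_mul_inv, div_le_one hb0] at h2
      have h4 : e * D ≤ b := by nlinarith [mul_nonneg he0 hD0.le, mul_nonneg he0 (sq_nonneg D)]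
      nlinarith
  have hY' : 2 ^ n * Y ≤ 1 / 4 * I := by
    rw [hbδ] at hest
    have e1 : 2 * (θ * r) ^ 2 * (caccioppoliConst n lam Lam * (N / r) ^ 2) = 2 * θ ^ 2 * C := by
      rw [hC]; field_simp
    rw [e1] at hest
    have h1 : 2 ^ n * (2 * θ ^ 2 * C) ≤ 1 / 8 := by
      rw [hθ2]
      have : 2 ^ n * (2 * (1 / (2 ^ n * 16 * (C + 1))) * C) = 1 / 8 * (C / (C + 1)) := by
        field_simp; ring
      rw [this]
      have : C / (C + 1) ≤ 1 := (div_le_one (by positivity)).2 (by linarith)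
      linarith
    have h2 : 2 ^ n * (2 * e * I) ≤ 1 / 8 * (θ ^ n * b * I) := by
      have h3 : e * I * (2 ^ n * 16) ≤ b * I * θ ^ n := by
        rw [hD, ← mul_div_assoc, div_le_iff₀ (by positivity)] at heI
        exact heI
      linarith
    have hp : 0 < θ ^ n * b := by positivity
    refine le_of_mul_le_mul_left ?_ hp
    calc θ ^ n * b * (2 ^ n * Y) = 2 ^ n * (θ ^ n * b * Y) := by ring
      _ ≤ 2 ^ n * ((θ ^ n * b * (2 * θ ^ 2 * C) + 2 * e) * I) :=
          mul_le_mul_of_nonneg_left hest (by positivity)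
      _ = θ ^ n * b * I * (2 ^ n * (2 * θ ^ 2 * C)) + 2 ^ n * (2 * e * I) := by ring
      _ ≤ θ ^ n * b * I * (1 / 8) + 1 / 8 * (θ ^ n * b * I) := by
          gcongr
      _ = _ := by ring
  refine abs_le_of_sq_le_sq' ?_ (by positivity) |>.2
  rw [l2avg_sq, hbhalf, mul_pow, hmI]
  have : ((1 / 2) ^ n * b)⁻¹ * Y = b⁻¹ * (2 ^ n * Y) := by
    rw [mul_inv, one_div, inv_pow, inv_inv]; ring
  rw [this]
  calc b⁻¹ * (2 ^ n * Y) ≤ b⁻¹ * (1 / 4 * I) := by gcongr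
    _ = _ := by ring

end Level

/-! ### Iteration on dyadic balls and the bound at the Lebesgue point. -/

section Iteration

variable {n : ℕ} {lam Lam : ℝ} {a : Eucl n → Matrix (Fin n) (Fin n) ℝ}

/-- The increasing truncation levels of the iteration on dyadic balls. -/
def truncationLevel (A : ℝ) (u : Eucl n → ℝ) : ℕ → ℝ
  | 0 => 0
  | k + 1 => truncationLevel A u k
      + A * l2avg ((1 / 2) ^ k) (fun x => max (u x - truncationLevel A u k) 0)

/-- The `L²` averages of the truncations along the iteration. -/
def truncationAvg (A : ℝ) (u : Eucl n → ℝ) (k : ℕ) : ℝ :=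
  l2avg ((1 / 2) ^ k) (fun x => max (u x - truncationLevel A u k) 0)

/-- The level property is applied to the nonnegative subsolution `(u - t_k)⁺` on the `k`-th ball.
Truncating it again at height `A m_k ≥ 0` gives `(u - t_{k+1})⁺`. -/
lemma truncationAvg_succ_le (hlam : 0 < lam) {A : ℝ} (hA : IsLevelConstant n lam Lam A)
    (ha : UniformlyElliptic (ballZero n 1) lam Lam a) {u : Eucl n → ℝ}
    (hu : IsNonnegSubsolution (ballZero n 1) a u) (k : ℕ) :
    truncationAvg A u (k + 1) ≤ 1 / 2 * truncationAvg A u k := by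
  have hr : (0 : ℝ) < (1 / 2) ^ k := by positivity
  have hr1 : ((1 : ℝ) / 2) ^ k ≤ 1 := pow_le_one₀ (by norm_num) (by norm_num)
  have hsub : ballZero n ((1 / 2) ^ k) ⊆ ballZero n 1 := Metric.ball_subset_ball hr1
  have h := hA.2 _ hr a (ha.mono hsub) _
    (hu.1.posPart Metric.isOpen_ball Metric.isOpen_ball hsub hlam.le ha (truncationLevel A u k))
  have hm : 0 ≤ A * truncationAvg A u k :=
    mul_nonneg (zero_le_one.trans hA.1.le) (l2avg_nonneg _ _)
  refine le_of_eq_of_le ?_ h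
  unfold truncationAvg at hm ⊢
  rw [pow_succ, mul_one_div]
  congr 1; ext x
  rw [truncationLevel]
  set c := truncationLevel A u k
  set d := A * l2avg ((1 / 2) ^ k) (fun x => max (u x - c) 0)
  rcases le_total (u x - c) 0 with hx | hx
  · rw [max_eq_right hx, max_eq_right (by linarith), max_eq_right (by linarith)]
  · rw [max_eq_left hx]; congr 1; ring

lemma truncationAvg_zero {A : ℝ} {u : Eucl n → ℝ}
    (hu : ∀ᵐ x ∂(volume.restrict (ballZero n 1)), 0 ≤ u x) :
    truncationAvg A u 0 = l2avg 1 u := by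
  unfold truncationAvg l2avg
  rw [pow_zero, truncationLevel]
  congr 1
  refine integral_congr_ae (Measure.ae_smul_measure ?_ _)
  filter_upwards [hu] with x hx
  rw [sub_zero, max_eq_left hx]

/-- The quantity `t_k + 2 A m_k` does not increase: the level gains `A m_k`, while halving `m_k`
lowers the second summand by at least as much. This sums the geometric series in invariant form. -/
lemma truncationLevel_le {A : ℝ} (hA : 0 ≤ A) {u : Eucl n → ℝ}
    (h : ∀ k, truncationAvg A u (k + 1) ≤ 1 / 2 * truncationAvg A u k) (k : ℕ) :
    truncationLevel A u k + 2 * A * truncationAvg A u k ≤ 2 * A * truncationAvg A u 0 := by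
  induction k with
  | zero => simp [truncationLevel]
  | succ k ih =>
    have h1 : truncationLevel A u (k + 1)
        = truncationLevel A u k + A * truncationAvg A u k := rfl
    have h2 := mul_le_mul_of_nonneg_left (h k) (mul_nonneg zero_le_two hA)
    linarith

lemma truncationAvg_le {A : ℝ} {u : Eucl n → ℝ}
    (h : ∀ k, truncationAvg A u (k + 1) ≤ 1 / 2 * truncationAvg A u k) (k : ℕ) :
    truncationAvg A u k ≤ (1 / 2) ^ k * truncationAvg A u 0 := by
  induction k with
  | zero => simp
  | succ k ih => rw [pow_succ]; linarith [h k]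

/-- The variance `∫ (f - M)²` about the mean `M` is nonnegative. -/
lemma setAverage_le_l2avg {r : ℝ} (hr : 0 < r) {f : Eucl n → ℝ}
    (hf : MemLp f 2 (volume.restrict (ballZero n r))) :
    ⨍ x in ballZero n r, f x ≤ l2avg r f := by
  have hb := measureReal_ballZero_pos (n := n) hr
  have h1 : Integrable f (volume.restrict (ballZero n r)) := hf.integrable (by norm_num)
  set M := ⨍ x in ballZero n r, f x with hM
  have hMI : ∫ x in ballZero n r, f x = volume.real (ballZero n r) * M := by
    rw [hM, setAverage_eq, smul_eq_mul, mul_inv_cancel_left₀ hb.ne']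
  have h2 : 0 ≤ ∫ x in ballZero n r, (f x - M) ^ 2 := integral_nonneg fun _ => sq_nonneg _
  have h3 : ∫ x in ballZero n r, (f x - M) ^ 2
      = (∫ x in ballZero n r, f x ^ 2) - volume.real (ballZero n r) * M ^ 2 := by
    have e : ∀ x, (f x - M) ^ 2 = f x ^ 2 - 2 * M * f x + M ^ 2 := fun x => by ring
    simp_rw [e]
    have h4 : Integrable (fun x => f x ^ 2 - 2 * M * f x) (volume.restrict (ballZero n r)) :=
      hf.integrable_sq.sub (h1.const_mul _)
    rw [integral_add h4 (integrable_const _), integral_sub hf.integrable_sq (h1.const_mul _), integral_const_mul, hMI,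
      setIntegral_const, smul_eq_mul]
    ring
  refine Real.le_sqrt_of_sq_le ?_
  rw [setAverage_eq, smul_eq_mul, inv_mul_eq_div, le_div_iff₀ hb]
  linarith

theorem le_of_isLebesguePointZero (hlam : 0 < lam) {A : ℝ} (hA : IsLevelConstant n lam Lam A)
    (ha : UniformlyElliptic (ballZero n 1) lam Lam a) {u : Eucl n → ℝ}
    (hu : IsNonnegSubsolution (ballZero n 1) a u) (hL : IsLebesguePointZero u) :
    u 0 ≤ 2 * A * l2avg 1 u := by
  have hA0 : 0 ≤ A := zero_le_one.trans hA.1.le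
  have hstep := truncationAvg_succ_le hlam hA ha hu
  have h0 := truncationAvg_zero (A := A) hu.2
  have hlev : ∀ k, truncationLevel A u k ≤ 2 * A * l2avg 1 u := fun k => by
    have := truncationLevel_le hA0 hstep k
    rw [h0] at this
    have h1 : 0 ≤ 2 * A * truncationAvg A u k :=
      mul_nonneg (mul_nonneg zero_le_two hA0) (l2avg_nonneg _ _)
    linarith
  have hu2 : MemLp u 2 (volume.restrict (ballZero n 1)) := hu.1.choose_spec.1.1
  set c := 2 * A * l2avg 1 u
  have hpos : ∀ k : ℕ, (0 : ℝ) < (1 / 2) ^ k := fun k => by positivity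
  have hr0 : Tendsto (fun k : ℕ => ((1 : ℝ) / 2) ^ k) atTop (𝓝[>] 0) :=
    tendsto_nhdsWithin_iff.2 ⟨tendsto_pow_atTop_nhds_zero_of_lt_one (by norm_num) (by norm_num),
      Eventually.of_forall hpos⟩
  have hlim : Tendsto (fun k : ℕ => (⨍ x in ballZero n ((1 / 2) ^ k), |u x - u 0|)
      + (1 / 2) ^ k * l2avg 1 u) atTop (𝓝 0) := by
    have h1 := (tendsto_nhdsWithin_iff.1 hr0).1.mul_const (l2avg 1 u)
    simpa using (Tendsto.comp hL hr0).add h1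
  -- Pointwise `u(0) - c ≤ |u - u(0)| + (u - t_k)⁺`, because `t_k ≤ c`. The average of the first
  -- summand vanishes in the limit by the Lebesgue point property, that of the second is at most
  -- `m_k ≤ 2⁻ᵏ m_0`.
  have hle : u 0 - c ≤ 0 := by
    refine ge_of_tendsto' hlim fun k => ?_
    have hb := measureReal_ballZero_pos (n := n) (hpos k)
    have hsub : ballZero n ((1 / 2) ^ k) ⊆ ballZero n 1 :=
      Metric.ball_subset_ball (pow_le_one₀ (by norm_num) (by norm_num))
    have huk : MemLp u 2 (volume.restrict (ballZero n ((1 / 2) ^ k))) :=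
      hu2.mono_measure (Measure.restrict_mono hsub le_rfl)
    have hw : MemLp (fun x => max (u x - truncationLevel A u k) 0) 2
        (volume.restrict (ballZero n ((1 / 2) ^ k))) := (huk.sub (memLp_const _)).pos_part
    have havg := (setAverage_le_l2avg (hpos k) hw).trans (truncationAvg_le hstep k)
    rw [h0] at havg
    refine le_trans ?_ (add_le_add_right havg _)
    have i1 : Integrable (fun x => |u x - u 0|)
        (volume.restrict (ballZero n ((1 / 2) ^ k))) :=
      ((huk.sub (memLp_const (u 0))).integrable (by norm_num)).abs
    have i2 := hw.integrable (q := 2) (by norm_num)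
    rw [setAverage_eq, setAverage_eq, smul_eq_mul, smul_eq_mul, ← mul_add,
      ← integral_add i1 i2, inv_mul_eq_div, le_div_iff₀ hb]
    have hconst : (u 0 - c) * volume.real (ballZero n ((1 / 2) ^ k))
        = ∫ _ in ballZero n ((1 / 2) ^ k), (u 0 - c) := by
      rw [setIntegral_const, smul_eq_mul, mul_comm]
    rw [hconst]
    refine integral_mono (integrable_const _) (i1.add i2) fun x => ?_
    have e1 : u 0 - u x ≤ |u x - u 0| := by rw [abs_sub_comm]; exact le_abs_self _
    have e2 := le_max_left (u x - truncationLevel A u k) 0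
    have e3 := hlev k
    simp only
    linarith
  linarith

end Iteration

end DeGiorgi

end

theorem mainTheorem7 (n : ℕ) (hn : 1 ≤ n) (lam Lam : ℝ) (hlam : 0 < lam) (hLam : lam ≤ Lam) :
    (∃ A : ℝ, DeGiorgi.IsLevelConstant n lam Lam A) ∧
    ∀ A : ℝ, DeGiorgi.IsLevelConstant n lam Lam A →
      ∀ a : DeGiorgi.Eucl n → Matrix (Fin n) (Fin n) ℝ,
        DeGiorgi.UniformlyElliptic (DeGiorgi.ballZero n 1) lam Lam a →
      ∀ u : DeGiorgi.Eucl n → ℝ,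
        DeGiorgi.IsNonnegSubsolution (DeGiorgi.ballZero n 1) a u →
        DeGiorgi.IsLebesguePointZero u →
        u 0 ≤ 2 * A * DeGiorgi.l2avg 1 u :=
  ⟨DeGiorgi.exists_isLevelConstant n hlam (hlam.le.trans hLam),
    fun _ hA _ ha _ hu hL => DeGiorgi.le_of_isLebesguePointZero hlam hA ha hu hL⟩
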